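/- Let $n\in\mathbb N$, let $|\cdot|$ be the Euclidean norm on $\mathbb R^n$, and let $\overline B_r$ be the closed ball of $\mathbb R^n$ with centre $0$ and radius $r$. Let $(\Omega,\mathcal F,\mathbb P)$ be a probability space with an ergodic group $(\tau_k)_{k\in\mathbb Z}$ of measure preserving transformations: $\tau_0=\mathrm{id}$, $\tau_{k+k'}=\tau_k\circ\tau_{k'}$, each $\tau_k$ preserves $\mathbb P$, and every $U\in\mathcal F$ with $\tau_k(U)=U$ for all $k\in\mathbb Z$ has $\mathbb P[U]\in\{0,1\}$. Let $a:\mathbb R^n\times\mathbb R\times\Omega\to\mathbb R$ satisfy assumption (A): * $a$ is measurable with respect to $\mathcal B(\mathbb R^{n+1})\otimes\mathcal F$; * $a(x+l,t,\tau_k\omega)=a(x,t+k,\omega)$ for all $x\in\mathbb R^n$, $l\in\mathbb Z^n$, $t\in\mathbb R$, $k\in\mathbb Z$, $\omega\in\Omega$; * for each $\omega\in\Omega$, the function $a(\cdot,\cdot,\omega)$ is Lipschitz continuous on $\mathbb R^{n+1}$, and there are constants $\alpha,\beta>0$ with $\alpha\le a(x,t,\omega)\le\beta$ for all $(x,t,\omega)$.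 Let $Y=[0,1]^n$. For $t\ge 0$ and $\omega\in\Omega$ let $\mathcal R_t(Y)(\omega)$ be the set of all $\gamma(t)$, where $\gamma:[0,t]\to\mathbb R^n$ is absolutely continuous with $\gamma(0)\in Y$ and $|\gamma'(r)|\le a(\gamma(r),r,\omega)$ for almost every $r\in[0,t]$. Let $\mathrm{co}$ denote the convex hull and, for integers $0\le m<k$, put $$X_{m,k}(\omega):=\mathrm{co}\,\mathcal R_{k-m}(Y)(\tau_m\omega)+(-Y).$$ Let $\mathscr C$ be the set of non-empty compact subsets of $\mathbb R^n$ and $\rho$ the Hausdorff metric on $\mathscr C$. **Theorem.** There exist a (deterministic) compact convex set $D\subset\mathbb R^n$ with $$\overline B_\alpha\subset D\subset\overline B_\beta$$ and an event $\Omega_0\in\mathcal F$ with $\mathbb P[\Omega_0]=1$ such that, for every $\omega\in\Omega_0$, as $m\to\infty$ along the positive integers, $$\frac{X_{0,m}(\omega)}{m}\longrightarrow D\qquad\text{and}\qquad\frac{\mathrm{co}\,\mathcal R_m(Y)(\omega)}{m}\longrightarrow D\qquad\text{in }(\mathscr C,\rho).$$ -/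

import Mathlib

open MeasureTheory Filter Topology
open scoped Pointwise

namespace ReachableSets

/-- An ergodic group `(τ_k)_{k ∈ ℤ}` of measure preserving transformations of the
probability space `(Ω, 𝓕, P)`: every event invariant under all `τ_k` has probability `0` or `1`. -/
structure IsErgodicGroup {Ω : Type*} [MeasurableSpace Ω] (P : Measure Ω) (τ : ℤ → Ω → Ω) :
    Prop where
  map_zero : τ 0 = id
  map_add : ∀ k k' : ℤ, τ (k + k') = τ k ∘ τ k'
  measurePreserving : ∀ k : ℤ, MeasurePreserving (τ k) P P
  ergodic : ∀ U : Set Ω, MeasurableSet U → (∀ k : ℤ, τ k '' U = U) → P U = 1 ∨ P U = 0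

/-- The standing assumption (A) on the velocity `a : ℝⁿ × ℝ × Ω → ℝ`: joint measurability,
`ℤⁿ`-periodicity in space and stationarity in time with respect to `τ`, Lipschitz continuity in
`(x, t)` for each `ω` (with a constant that may depend on `ω`), and the uniform bounds
`0 < α ≤ a ≤ β`. -/
structure AssumptionA {n : ℕ} {Ω : Type*} [MeasurableSpace Ω] (τ : ℤ → Ω → Ω)
    (a : EuclideanSpace ℝ (Fin n) → ℝ → Ω → ℝ) (α β : ℝ) : Prop where
  measurable : Measurable
    (fun p : (EuclideanSpace ℝ (Fin n) × ℝ) × Ω => a p.1.1 p.1.2 p.2)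
  periodic_stationary : ∀ (x l : EuclideanSpace ℝ (Fin n)), (∀ i, ∃ z : ℤ, l i = z) →
    ∀ (t : ℝ) (k : ℤ) (ω : Ω), a (x + l) t (τ k ω) = a x (t + k) ω
  lipschitz : ∀ ω : Ω, ∃ K : NNReal,
    LipschitzWith K (fun p : EuclideanSpace ℝ (Fin n) × ℝ => a p.1 p.2 ω)
  alpha_pos : 0 < α
  beta_pos : 0 < β
  lower : ∀ x t ω, α ≤ a x t ω
  upper : ∀ x t ω, a x t ω ≤ β

/-- The unit cell `Y = [0,1]ⁿ`. -/
def unitCell (n : ℕ) : Set (EuclideanSpace ℝ (Fin n)) :=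
  {x | ∀ i, 0 ≤ x i ∧ x i ≤ 1}

/-- Admissible paths `𝒜_{s,t}(ω)`: absolutely continuous `γ : [s,t] → ℝⁿ` such that
`|γ'(r)| ≤ a(γ(r), r, ω)` for almost every `r ∈ [s,t]`. A path is represented by a function on `ℝ`
of which only the values on `[s,t]` matter (the end points are a null set). -/
def admissible {n : ℕ} {Ω : Type*} (a : EuclideanSpace ℝ (Fin n) → ℝ → Ω → ℝ)
    (s t : ℝ) (ω : Ω) : Set (ℝ → EuclideanSpace ℝ (Fin n)) :=
  {γ | AbsolutelyContinuousOnInterval γ s t ∧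
    ∀ᵐ r ∂(volume : Measure ℝ), r ∈ Set.Icc s t →
      DifferentiableAt ℝ γ r ∧ ‖deriv γ r‖ ≤ a (γ r) r ω}

/-- The reachable set `ℛ_t(x, s)(ω)` at time `t ≥ s`, starting from `x` at time `s`. -/
def reach {n : ℕ} {Ω : Type*} (a : EuclideanSpace ℝ (Fin n) → ℝ → Ω → ℝ)
    (t : ℝ) (x : EuclideanSpace ℝ (Fin n)) (s : ℝ) (ω : Ω) : Set (EuclideanSpace ℝ (Fin n)) :=
  {y | ∃ γ ∈ admissible a s t ω, γ s = x ∧ γ t = y}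

/-- The enlarged reachable set `ℛ_t(Y)(ω) = ⋃_{x ∈ Y} ℛ_t(x, 0)(ω)`. -/
def reachY {n : ℕ} {Ω : Type*} (a : EuclideanSpace ℝ (Fin n) → ℝ → Ω → ℝ)
    (t : ℝ) (ω : Ω) : Set (EuclideanSpace ℝ (Fin n)) :=
  ⋃ x ∈ unitCell n, reach a t x 0 ω

/-- The family `X_{m,k}(ω) = co ℛ_{k-m}(Y)(τ_m ω) + (-Y)`, for `0 ≤ m < k`. -/
def X {n : ℕ} {Ω : Type*} (τ : ℤ → Ω → Ω) (a : EuclideanSpace ℝ (Fin n) → ℝ → Ω → ℝ)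
    (m k : ℕ) (ω : Ω) : Set (EuclideanSpace ℝ (Fin n)) :=
  convexHull ℝ (reachY a ((k : ℝ) - (m : ℝ)) (τ (m : ℤ) ω)) + (-unitCell n)

/-- `A_m → D`, as `m → ∞`, in the space of non-empty compact subsets of `ℝⁿ` with the
Hausdorff metric: all the sets (for integers `m ≥ 1`) belong to that space, and the Hausdorff
distance tends to `0`. -/
def TendstoHausdorff {n : ℕ} (A : ℕ → Set (EuclideanSpace ℝ (Fin n)))
    (D : Set (EuclideanSpace ℝ (Fin n))) : Prop :=
  (∀ m : ℕ, 1 ≤ m → (A m).Nonempty ∧ IsCompact (A m)) ∧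
  (D.Nonempty ∧ IsCompact D) ∧
  Tendsto (fun m : ℕ => Metric.hausdorffDist (A m) D) atTop (𝓝 0)

end ReachableSets

/-!
For a direction `u`, let `h_m(ω)` be the support function of `ℛ_m(Y)(ω)` at `u`. A path of length
`m + k`, cut at time `m` and translated by a lattice vector, splits into a path for `ω` and one for
`τ_m ω`. Conversely, after any path of length `m` one can steer at speed `α`, in the time `√n / α`,
to a lattice translate of a given path for `τ_m ω`. Hence `h_{m+k}(ω)` differs from
`h_m(ω) + h_k(τ_m ω)` by at most a constant, and `h_m / m` differs asymptotically by `O(1 / L)` from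
the Birkhoff averages of `h_L / L`. The pointwise ergodic theorem, a consequence of the maximal
inequality, therefore gives almost sure convergence of `h_m / m` to a deterministic limit. The
support functions of the sets `co ℛ_m(Y) / m` are equi-Lipschitz in `u`, so a countable dense set of
directions controls the Hausdorff distance. The summand `-Y / m` vanishes in the limit.

In integrated form, `|γ(r') - γ(r)| ≤ ∫ u in r..r', a(γ(u), u, ω)`, the speed constraint is closed
under uniform limits. By the Arzelà–Ascoli theorem this makes the reachable sets compact, and it
reduces the existence of an admissible path with a prescribed end point to countably many
conditions, which makes `h_m` measurable.
-/

namespace ReachableSets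

section Ergodic

theorem integral_comp_of_measurePreserving {Ω Ω' E : Type*} [MeasurableSpace Ω]
    [MeasurableSpace Ω'] [NormedAddCommGroup E] [NormedSpace ℝ E] {P : Measure Ω} {Q : Measure Ω'}
    {T : Ω → Ω'} {g : Ω' → E} (hT : MeasurePreserving T P Q) (hg : AEStronglyMeasurable g Q) :
    ∫ ω, g (T ω) ∂P = ∫ ω, g ω ∂Q := by
  rw [← integral_map hT.aemeasurable (by rwa [hT.map_eq]), hT.map_eq]

variable {Ω : Type*} {T : Ω → Ω} {g : Ω → ℝ}

/-- The running maximum `max (0, S₁, …, Sₙ)` of the Birkhoff sums of `g` along `T`, written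
recursively so that it can be compared with its own composition with `T`. -/
noncomputable def birkhoffMax (T : Ω → Ω) (g : Ω → ℝ) : ℕ → Ω → ℝ
  | 0 => fun _ => 0
  | n + 1 => fun ω => max 0 (g ω + birkhoffMax T g n (T ω))

theorem birkhoffMax_nonneg (n : ℕ) (ω : Ω) : 0 ≤ birkhoffMax T g n ω := by
  cases n with
  | zero => exact le_rfl
  | succ n => exact le_max_left _ _

theorem birkhoffMax_mono (ω : Ω) : Monotone fun n => birkhoffMax T g n ω := by
  refine monotone_nat_of_le_succ fun n => ?_
  induction n generalizing ω with
  | zero => exact birkhoffMax_nonneg 1 ω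
  | succ n ih => exact max_le_max le_rfl (add_le_add le_rfl (ih _))

theorem birkhoffSum_le_birkhoffMax (n : ℕ) (ω : Ω) :
    birkhoffSum T g n ω ≤ birkhoffMax T g n ω := by
  induction n generalizing ω with
  | zero => simp [birkhoffMax]
  | succ n ih =>
    rw [birkhoffSum_succ']
    exact le_max_of_le_right (add_le_add le_rfl (ih _))

theorem birkhoffMax_sub_comp_le_indicator (n : ℕ) (ω : Ω) :
    birkhoffMax T g n ω - birkhoffMax T g n (T ω) ≤
      Set.indicator {ω | 0 < birkhoffMax T g n ω} g ω := by
  rcases (birkhoffMax_nonneg (T := T) (g := g) n ω).eq_or_lt with hzero | hpos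
  · rw [Set.indicator_of_notMem (s := {ω | 0 < birkhoffMax T g n ω}) fun h => h.ne hzero, ← hzero]
    linarith [birkhoffMax_nonneg (T := T) (g := g) n (T ω)]
  · rw [Set.indicator_of_mem (show ω ∈ {ω | 0 < birkhoffMax T g n ω} from hpos)]
    cases n with
    | zero => exact absurd hpos (lt_irrefl _)
    | succ n =>
      have hmax : birkhoffMax T g (n + 1) ω = g ω + birkhoffMax T g n (T ω) :=
        max_eq_right (le_of_not_gt fun hneg => hpos.ne' (max_eq_left hneg.le))
      linarith [birkhoffMax_mono (T := T) (g := g) (T ω) n.le_succ]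

theorem bddAbove_birkhoffSum_comp_iff (ω : Ω) :
    BddAbove (Set.range fun n => birkhoffSum T g n (T ω)) ↔
      BddAbove (Set.range fun n => birkhoffSum T g n ω) := by
  simp only [bddAbove_def, Set.forall_mem_range]
  constructor
  · rintro ⟨C, hC⟩
    refine ⟨max 0 (g ω + C), fun n => ?_⟩
    cases n with
    | zero => simp
    | succ n =>
      rw [birkhoffSum_succ']
      exact le_max_of_le_right (add_le_add le_rfl (hC n))
  · rintro ⟨C, hC⟩
    refine ⟨C - g ω, fun n => ?_⟩
    have := hC (n + 1)
    rw [birkhoffSum_succ'] at this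
    linarith

theorem bddBelow_range_div {u : ℕ → ℝ} {b : ℝ} (h : ∀ n : ℕ, n * b ≤ u n) :
    BddBelow (Set.range fun n : ℕ => u n / n) := by
  refine ⟨min 0 b, Set.forall_mem_range.2 fun n => ?_⟩
  rcases n.eq_zero_or_pos with rfl | hn
  · simp
  · exact min_le_of_right_le ((le_div_iff₀' (by positivity)).2 (h n))

/-- This is Hyers' argument: `s + C` and `C - s` are both subadditive. -/
theorem exists_abs_div_sub_le_of_almost_additive {s : ℕ → ℝ} {C : ℝ}
    (hs : ∀ m k, |s (m + k) - s m - s k| ≤ C) :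
    ∃ c, ∀ n ≠ 0, |s n / n - c| ≤ C / n := by
  have hu : Subadditive fun n => s n + C := fun m k => by linarith [(abs_le.1 (hs m k)).2]
  have hv : Subadditive fun n => C - s n := fun m k => by linarith [(abs_le.1 (hs m k)).1]
  have hu_le : ∀ n : ℕ, s n + C ≤ n * (s 1 + C) + (s 0 + C) := fun n => by
    simpa using hu.apply_mul_add_le n 1 0
  have hv_le : ∀ n : ℕ, C - s n ≤ n * (C - s 1) + (C - s 0) := fun n => by
    simpa using hv.apply_mul_add_le n 1 0
  have hs0 : |s 0| ≤ C := by simpa using hs 0 0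
  rw [abs_le] at hs0
  have hu_bdd : BddBelow (Set.range fun n : ℕ => (s n + C) / n) :=
    bddBelow_range_div (b := s 1 - C) fun n => by linarith [hv_le n]
  have hv_bdd : BddBelow (Set.range fun n : ℕ => (C - s n) / n) :=
    bddBelow_range_div (b := -C - s 1) fun n => by linarith [hu_le n]
  have hlim : hv.lim = -hu.lim := by
    refine tendsto_nhds_unique (hv.tendsto_lim hv_bdd) ?_
    have := (tendsto_const_div_atTop_nhds_zero_nat (2 * C)).sub (hu.tendsto_lim hu_bdd)
    rw [zero_sub] at this
    exact this.congr fun n => by ring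
  refine ⟨hu.lim, fun n hn => abs_le.2 ?_⟩
  have hu_lim := hu.lim_le_div hu_bdd hn
  have hv_lim := hv.lim_le_div hv_bdd hn
  simp only [hlim, add_div, sub_div] at hu_lim hv_lim
  constructor <;> linarith

theorem abs_birkhoffSum_sub_mul_le {f : ℕ → Ω → ℝ} {C : ℝ}
    (hf : ∀ m k ω, |f (m + k) ω - f m ω - f k (T^[m] ω)| ≤ C) (L m : ℕ) (ω : Ω) :
    |birkhoffSum T (f L) m ω - L * f m ω| ≤
      m * C + ∑ j ∈ Finset.range L, (C + |f j (T^[m] ω)| + |f j ω|) := by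
  have hswap : ∑ i ∈ Finset.range m, (f (i + L) ω - f i ω) =
      ∑ j ∈ Finset.range L, (f (m + j) ω - f j ω) := by
    have hmL := Finset.sum_range_add (fun i => f i ω) m L
    have hLm := Finset.sum_range_add (fun i => f i ω) L m
    simp only [add_comm L] at hLm
    simp only [Finset.sum_sub_distrib]
    linarith
  have hrows : |birkhoffSum T (f L) m ω - ∑ i ∈ Finset.range m, (f (i + L) ω - f i ω)| ≤
      ∑ _i ∈ Finset.range m, C := by
    rw [birkhoffSum, ← Finset.sum_sub_distrib]
    refine Finset.abs_sum_le_sum_abs _ _ |>.trans (Finset.sum_le_sum fun i _ => ?_)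
    rw [abs_sub_comm]
    exact hf i L ω
  have hcols : |∑ j ∈ Finset.range L, (f (m + j) ω - f j ω) - ∑ _j ∈ Finset.range L, f m ω| ≤
      ∑ j ∈ Finset.range L, (C + |f j (T^[m] ω)| + |f j ω|) := by
    rw [← Finset.sum_sub_distrib]
    refine Finset.abs_sum_le_sum_abs _ _ |>.trans (Finset.sum_le_sum fun j _ => ?_)
    calc |f (m + j) ω - f j ω - f m ω|
        = |(f (m + j) ω - f m ω - f j (T^[m] ω)) + f j (T^[m] ω) - f j ω| := by ring_nf
      _ ≤ |f (m + j) ω - f m ω - f j (T^[m] ω)| + |f j (T^[m] ω)| + |f j ω| :=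
          (abs_sub _ _).trans (add_le_add_left (abs_add_le _ _) _)
      _ ≤ C + |f j (T^[m] ω)| + |f j ω| := by gcongr; exact hf m j ω
  rw [hswap] at hrows
  simp only [Finset.sum_const, Finset.card_range, nsmul_eq_mul] at hrows hcols
  exact (abs_sub_le _ _ _).trans (add_le_add hrows hcols)

theorem abs_div_sub_birkhoffAverage_div_le {f : ℕ → Ω → ℝ} {C : ℝ}
    (hf : ∀ m k ω, |f (m + k) ω - f m ω - f k (T^[m] ω)| ≤ C) {L m : ℕ} (hL : L ≠ 0) (hm : m ≠ 0)
    (ω : Ω) :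
    |f m ω / m - birkhoffAverage ℝ T (f L) m ω / L| ≤
      C / L + (∑ j ∈ Finset.range L, (C / m + |f j (T^[m] ω) / m| + |f j ω| / m)) / L := by
  have hdiff : f m ω / m - birkhoffAverage ℝ T (f L) m ω / L =
      -((birkhoffSum T (f L) m ω - L * f m ω) / (L * m)) := by
    rw [birkhoffAverage, smul_eq_mul]
    field_simp
    ring
  rw [hdiff, abs_neg, abs_div, abs_of_nonneg (by positivity : (0 : ℝ) ≤ L * m),
    div_le_iff₀ (by positivity)]
  refine (abs_birkhoffSum_sub_mul_le hf L m ω).trans_eq ?_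
  simp only [abs_div, Nat.abs_cast, ← add_div, ← Finset.sum_div]
  field_simp

variable [MeasurableSpace Ω] {P : Measure Ω}

theorem integrable_birkhoffMax (hT : MeasurePreserving T P P) (hg : Integrable g P) (n : ℕ) :
    Integrable (birkhoffMax T g n) P := by
  induction n with
  | zero => exact integrable_zero _ _ _
  | succ n ih => exact (integrable_zero _ _ _).sup (hg.add (hT.integrable_comp_of_integrable ih))

theorem nullMeasurableSet_birkhoffMax_pos (hT : MeasurePreserving T P P) (hg : Integrable g P)
    (n : ℕ) : NullMeasurableSet {ω | 0 < birkhoffMax T g n ω} P :=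
  nullMeasurableSet_lt aemeasurable_const (integrable_birkhoffMax hT hg n).aemeasurable

theorem setIntegral_birkhoffMax_pos_nonneg (hT : MeasurePreserving T P P) (hg : Integrable g P)
    (n : ℕ) : 0 ≤ ∫ ω in {ω | 0 < birkhoffMax T g n ω}, g ω ∂P := by
  have hpos := nullMeasurableSet_birkhoffMax_pos hT hg n
  have hM := integrable_birkhoffMax hT hg n
  have hMT : Integrable (fun ω => birkhoffMax T g n (T ω)) P := hT.integrable_comp_of_integrable hM
  calc 0 = ∫ ω, (birkhoffMax T g n ω - birkhoffMax T g n (T ω)) ∂P := by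
        rw [integral_sub hM hMT, integral_comp_of_measurePreserving hT hM.aestronglyMeasurable,
          sub_self]
    _ ≤ ∫ ω, Set.indicator {ω | 0 < birkhoffMax T g n ω} g ω ∂P :=
        integral_mono (hM.sub hMT) (hg.indicator₀ hpos) (birkhoffMax_sub_comp_le_indicator n)
    _ = ∫ ω in {ω | 0 < birkhoffMax T g n ω}, g ω ∂P := integral_indicator₀ hpos

theorem setIntegral_iUnion_birkhoffMax_pos_nonneg (hT : MeasurePreserving T P P)
    (hg : Integrable g P) : 0 ≤ ∫ ω in ⋃ n, {ω | 0 < birkhoffMax T g n ω}, g ω ∂P := by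
  have hmono : Monotone fun n => {ω | 0 < birkhoffMax T g n ω} :=
    fun m n hmn ω hω => lt_of_lt_of_le hω (birkhoffMax_mono ω hmn)
  exact ge_of_tendsto' (tendsto_setIntegral_of_monotone₀
    (nullMeasurableSet_birkhoffMax_pos hT hg) hmono hg.integrableOn)
    (setIntegral_birkhoffMax_pos_nonneg hT hg)

theorem integrable_birkhoffSum (hT : MeasurePreserving T P P) (hg : Integrable g P) (n : ℕ) :
    Integrable (birkhoffSum T g n) P :=
  integrable_finsetSum _ fun i _ => (hT.iterate i).integrable_comp_of_integrable hg

theorem nullMeasurableSet_bddAbove_birkhoffSum (hT : MeasurePreserving T P P)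
    (hg : Integrable g P) :
    NullMeasurableSet {ω | BddAbove (Set.range fun n => birkhoffSum T g n ω)} P := by
  have hcountable : {ω | BddAbove (Set.range fun n => birkhoffSum T g n ω)} =
      ⋃ C : ℕ, ⋂ n, {ω | birkhoffSum T g n ω ≤ C} := by
    ext ω
    simp only [Set.mem_ofPred_eq, Set.mem_iUnion, Set.mem_iInter, bddAbove_def,
      Set.forall_mem_range]
    refine ⟨fun ⟨C, hC⟩ => ?_, fun ⟨C, hC⟩ => ⟨C, hC⟩⟩
    obtain ⟨N, hN⟩ := exists_nat_ge C
    exact ⟨N, fun n => (hC n).trans hN⟩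
  rw [hcountable]
  exact .iUnion fun C => .iInter fun n =>
    nullMeasurableSet_le (integrable_birkhoffSum hT hg n).aemeasurable aemeasurable_const

theorem ae_bddAbove_birkhoffSum (hT : Ergodic T P) (hg : Integrable g P)
    (hneg : ∫ ω, g ω ∂P < 0) :
    ∀ᵐ ω ∂P, BddAbove (Set.range fun n => birkhoffSum T g n ω) := by
  have hinv : T ⁻¹' {ω | BddAbove (Set.range fun n => birkhoffSum T g n ω)} =
      {ω | BddAbove (Set.range fun n => birkhoffSum T g n ω)} :=
    Set.ext bddAbove_birkhoffSum_comp_iff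
  refine (hT.quasiErgodic.ae_mem_or_ae_notMem₀ (nullMeasurableSet_bddAbove_birkhoffSum
    hT.toMeasurePreserving hg) (.of_eq hinv)).resolve_right fun hunbdd => hneg.not_ge ?_
  have hpos : (⋃ n, {ω | 0 < birkhoffMax T g n ω}) =ᵐ[P] Set.univ := by
    refine eventuallyEq_univ.2 ?_
    filter_upwards [hunbdd] with ω hω
    by_contra hnonpos
    simp only [Set.mem_iUnion, Set.mem_ofPred_eq, not_exists, not_lt] at hnonpos
    exact hω ⟨0, Set.forall_mem_range.2 fun n =>
      (birkhoffSum_le_birkhoffMax n ω).trans (hnonpos n)⟩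
  rw [← setIntegral_univ, ← setIntegral_congr_set hpos]
  exact setIntegral_iUnion_birkhoffMax_pos_nonneg hT.toMeasurePreserving hg

theorem ae_eventually_birkhoffAverage_lt [IsProbabilityMeasure P] (hT : Ergodic T P)
    (hg : Integrable g P) {c : ℝ} (hc : ∫ ω, g ω ∂P < c) :
    ∀ᵐ ω ∂P, ∀ᶠ n in atTop, birkhoffAverage ℝ T g n ω < c := by
  obtain ⟨c', hgc', hc'c⟩ := exists_between hc
  have hneg : ∫ ω, (g ω - c') ∂P < 0 := by
    simpa [integral_sub hg (integrable_const c')] using hgc'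
  filter_upwards [ae_bddAbove_birkhoffSum hT (hg.sub (integrable_const c')) hneg] with ω ⟨C, hC⟩
  have hlim : Tendsto (fun n : ℕ => c' + C / n) atTop (𝓝 (c' + 0)) :=
    (tendsto_const_div_atTop_nhds_zero_nat C).const_add c'
  rw [add_zero] at hlim
  filter_upwards [hlim.eventually (gt_mem_nhds hc'c), eventually_gt_atTop 0] with n hn hn_pos
  have hsum : birkhoffSum T g n ω - n * c' ≤ C := by
    simpa [birkhoffSum] using hC ⟨n, rfl⟩
  refine lt_of_le_of_lt ?_ hn
  rw [birkhoffAverage, smul_eq_mul, inv_mul_le_iff₀ (by positivity)]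
  field_simp
  linarith

theorem ae_tendsto_birkhoffAverage [IsProbabilityMeasure P] (hT : Ergodic T P)
    (hg : Integrable g P) :
    ∀ᵐ ω ∂P, Tendsto (fun n => birkhoffAverage ℝ T g n ω) atTop (𝓝 (∫ ω, g ω ∂P)) := by
  obtain ⟨u, -, hu, hu_lim⟩ := exists_seq_strictAnti_tendsto (∫ ω, g ω ∂P)
  obtain ⟨v, -, hv, hv_lim⟩ := exists_seq_strictAnti_tendsto (∫ ω, (-g) ω ∂P)
  filter_upwards [ae_all_iff.2 fun j => ae_eventually_birkhoffAverage_lt hT hg (hu j),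
    ae_all_iff.2 fun j => ae_eventually_birkhoffAverage_lt hT hg.neg (hv j)] with ω hupper hlower
  refine tendsto_order.2 ⟨fun b hb => ?_, fun b hb => ?_⟩
  · have hb' : ∫ ω, (-g) ω ∂P < -b := by
      simp only [Pi.neg_apply, integral_neg]
      linarith
    obtain ⟨j, hj⟩ := (hv_lim.eventually (gt_mem_nhds hb')).exists
    filter_upwards [hlower j] with n hn
    rw [birkhoffAverage_neg, Pi.neg_apply, Pi.neg_apply] at hn
    linarith
  · obtain ⟨j, hj⟩ := (hu_lim.eventually (gt_mem_nhds hb)).exists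
    filter_upwards [hupper j] with n hn
    exact hn.trans hj

theorem ae_tendsto_iterate_div_atTop [IsProbabilityMeasure P] (hT : Ergodic T P)
    (hg : Integrable g P) :
    ∀ᵐ ω ∂P, Tendsto (fun n : ℕ => g (T^[n] ω) / n) atTop (𝓝 0) := by
  filter_upwards [ae_tendsto_birkhoffAverage hT hg] with ω hω
  have hratio : Tendsto (fun n : ℕ => 1 + 1 / (n : ℝ)) atTop (𝓝 (1 + 0)) :=
    tendsto_one_div_atTop_nhds_zero_nat.const_add 1
  have hlim := (hratio.mul (hω.comp (tendsto_add_atTop_nat 1))).sub hω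
  rw [add_zero, one_mul, sub_self] at hlim
  refine hlim.congr' ?_
  filter_upwards [eventually_gt_atTop 0] with n hn
  simp only [Function.comp_apply, birkhoffAverage, birkhoffSum_succ, smul_eq_mul, Nat.cast_add,
    Nat.cast_one]
  field_simp
  ring

theorem exists_abs_integral_div_sub_le_of_almost_additive [IsProbabilityMeasure P]
    (hT : MeasurePreserving T P P) {f : ℕ → Ω → ℝ} {C : ℝ} (hint : ∀ m, Integrable (f m) P)
    (hf : ∀ m k ω, |f (m + k) ω - f m ω - f k (T^[m] ω)| ≤ C) :
    ∃ c, ∀ n ≠ 0, |(∫ ω, f n ω ∂P) / n - c| ≤ C / n := by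
  refine exists_abs_div_sub_le_of_almost_additive fun m k => ?_
  have hcomp : Integrable (fun ω => f k (T^[m] ω)) P :=
    (hT.iterate m).integrable_comp_of_integrable (hint k)
  have hsub : Integrable (fun ω => f (m + k) ω - f m ω) P := (hint _).sub (hint _)
  calc |∫ ω, f (m + k) ω ∂P - ∫ ω, f m ω ∂P - ∫ ω, f k ω ∂P|
      = ‖∫ ω, (f (m + k) ω - f m ω - f k (T^[m] ω)) ∂P‖ := by
        rw [integral_sub hsub hcomp, integral_sub (hint _) (hint _),
          integral_comp_of_measurePreserving (hT.iterate m) (hint k).aestronglyMeasurable,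
          Real.norm_eq_abs]
    _ ≤ C * P.real Set.univ := norm_integral_le_of_norm_le_const (ae_of_all _ (hf m k))
    _ = C := by simp

/-- In the limit `m → ∞` the quotients `f m ω / m` and the Birkhoff averages of `f L / L` differ by
at most `C / L`, so that Birkhoff's theorem for the single functions `f L` suffices. -/
theorem exists_ae_tendsto_div_of_almost_additive [IsProbabilityMeasure P] (hT : Ergodic T P)
    {f : ℕ → Ω → ℝ} {C : ℝ} (hint : ∀ m, Integrable (f m) P)
    (hf : ∀ m k ω, |f (m + k) ω - f m ω - f k (T^[m] ω)| ≤ C) :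
    ∃ c : ℝ, ∀ᵐ ω ∂P, Tendsto (fun m : ℕ => f m ω / m) atTop (𝓝 c) := by
  obtain ⟨c, hc⟩ := exists_abs_integral_div_sub_le_of_almost_additive hT.toMeasurePreserving hint hf
  refine ⟨c, ?_⟩
  filter_upwards [ae_all_iff.2 fun L => ae_tendsto_birkhoffAverage hT (hint L),
    ae_all_iff.2 fun j => ae_tendsto_iterate_div_atTop hT (hint j)] with ω hbirkhoff hiterate
  let err : ℕ → ℕ → ℝ := fun L m => |birkhoffAverage ℝ T (f L) m ω - ∫ ω, f L ω ∂P| / L +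
    (∑ j ∈ Finset.range L, (C / m + |f j (T^[m] ω) / m| + |f j ω| / m)) / L
  have herr_lim : ∀ L, Tendsto (fun m => err L m) atTop (𝓝 0) := fun L => by
    have hbdry := tendsto_finsetSum (Finset.range L) fun j _ =>
      ((tendsto_const_div_atTop_nhds_zero_nat C).add (hiterate j).abs).add
        (tendsto_const_div_atTop_nhds_zero_nat |f j ω|)
    have hmean := ((hbirkhoff L).sub_const (∫ ω, f L ω ∂P)).abs.div_const (L : ℝ)
    simpa using hmean.add (hbdry.div_const (L : ℝ))
  have hbound : ∀ L ≠ 0, ∀ m ≠ 0, |f m ω / m - c| ≤ 2 * C / L + err L m := fun L hL m hm => by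
    have hmean : |birkhoffAverage ℝ T (f L) m ω / L - (∫ ω, f L ω ∂P) / L| =
        |birkhoffAverage ℝ T (f L) m ω - ∫ ω, f L ω ∂P| / L := by
      rw [← sub_div, abs_div, Nat.abs_cast]
    have htriangle := (abs_sub_le (f m ω / m) (birkhoffAverage ℝ T (f L) m ω / L) c).trans
      (add_le_add (abs_div_sub_birkhoffAverage_div_le hf hL hm ω)
        (abs_sub_le _ ((∫ ω, f L ω ∂P) / L) _))
    rw [hmean] at htriangle
    simp only [err]
    linarith [hc L hL, show 2 * C / L = C / L + C / L by ring]
  refine Metric.tendsto_nhds.2 fun ε hε => ?_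
  obtain ⟨L, hL, hL0⟩ := (((tendsto_const_div_atTop_nhds_zero_nat (2 * C)).eventually
    (gt_mem_nhds (half_pos hε))).and (eventually_ne_atTop 0)).exists
  filter_upwards [(herr_lim L).eventually (gt_mem_nhds (half_pos hε)), eventually_ne_atTop 0]
    with m hm hm0
  rw [Real.dist_eq]
  linarith [hbound L hL0 m hm0]

end Ergodic

section Convex

open Metric Bornology

theorem isCompact_convexHull {E : Type*} [AddCommGroup E] [Module ℝ E] [TopologicalSpace E]
    [IsTopologicalAddGroup E] [ContinuousSMul ℝ E] [FiniteDimensional ℝ E] {s : Set E}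
    (hs : IsCompact s) : IsCompact (convexHull ℝ s) := by
  have hcaratheodory : convexHull ℝ s = ⋃ k ∈ Finset.range (Module.finrank ℝ E + 2),
      (fun p : (Fin k → ℝ) × (Fin k → E) => ∑ i, p.1 i • p.2 i) ''
        (stdSimplex ℝ (Fin k) ×ˢ Set.univ.pi fun _ => s) := by
    refine Set.Subset.antisymm (fun x hx => ?_) (Set.iUnion₂_subset fun k _ => ?_)
    · obtain ⟨ι, hι, z, w, hz, hind, hw, hw1, rfl⟩ := eq_pos_convex_span_of_mem_convexHull hx
      have hcard : Fintype.card ι ≤ Module.finrank ℝ E + 1 :=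
        hind.card_le_finrank_succ.trans (Nat.succ_le_succ (Submodule.finrank_le _))
      let e := Fintype.equivFin ι
      exact Set.mem_biUnion (x := Fintype.card ι) (Finset.mem_range.2 (Nat.lt_succ_of_le hcard))
        ⟨(fun i => w (e.symm i), fun i => z (e.symm i)),
          ⟨⟨fun i => (hw _).le, (e.symm.sum_comp w).trans hw1⟩, fun i _ => hz ⟨_, rfl⟩⟩,
          e.symm.sum_comp fun i => w i • z i⟩
    · rintro _ ⟨⟨w, z⟩, ⟨⟨hw, hw1⟩, hz⟩, rfl⟩
      exact (convex_convexHull ℝ s).sum_mem (fun i _ => hw i) hw1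
        fun i _ => subset_convexHull ℝ s (hz i trivial)
  rw [hcaratheodory]
  refine (Finset.range _).isCompact_biUnion fun k _ => ?_
  refine ((isCompact_stdSimplex ℝ (Fin k)).prod (isCompact_univ_pi fun _ => hs)).image ?_
  fun_prop

variable {E : Type*} [NormedAddCommGroup E] [InnerProductSpace ℝ E] {s t : Set E} {u v x : E}
  {c M : ℝ}

/-- The support function `h_s(u) = sup {⟪u, x⟫ | x ∈ s}` of a set, through which convex bodies are
compared. It has a junk value when `s` is empty or `⟪u, ·⟫` is unbounded on `s`. -/
noncomputable def supportFn (s : Set E) (u : E) : ℝ := sSup (inner ℝ u '' s)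

theorem bddAbove_inner_image (hs : IsBounded s) (u : E) : BddAbove (inner ℝ u '' s) := by
  obtain ⟨M, hM⟩ := hs.exists_norm_le
  refine ⟨‖u‖ * M, Set.forall_mem_image.2 fun x hx => (real_inner_le_norm u x).trans ?_⟩
  exact mul_le_mul_of_nonneg_left (hM x hx) (norm_nonneg u)

theorem inner_le_supportFn (hs : IsBounded s) (hx : x ∈ s) : inner ℝ u x ≤ supportFn s u :=
  le_csSup (bddAbove_inner_image hs u) ⟨x, hx, rfl⟩

theorem supportFn_le (hs : s.Nonempty) (h : ∀ x ∈ s, inner ℝ u x ≤ c) : supportFn s u ≤ c :=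
  csSup_le (hs.image _) (Set.forall_mem_image.2 h)

theorem le_supportFn_iff (hs : IsCompact s) (hne : s.Nonempty) :
    c ≤ supportFn s u ↔ ∃ x ∈ s, c ≤ inner ℝ u x := by
  constructor
  · obtain ⟨x, hx, hmax, -⟩ := hs.exists_sSup_image_eq_and_ge hne
      (by fun_prop : Continuous (inner ℝ u : E → ℝ)).continuousOn
    exact fun h => ⟨x, hx, h.trans_eq hmax⟩
  · rintro ⟨x, hx, h⟩
    exact h.trans (inner_le_supportFn hs.isBounded hx)

theorem supportFn_convexHull (hs : IsBounded s) (hne : s.Nonempty) (u : E) :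
    supportFn (convexHull ℝ s) u = supportFn s u := by
  refine le_antisymm (supportFn_le hne.convexHull fun x hx => ?_) (supportFn_le hne fun x hx =>
    inner_le_supportFn (isBounded_convexHull.2 hs) (subset_convexHull ℝ s hx))
  have hhalf : convexHull ℝ s ⊆ {y | inner ℝ u y ≤ supportFn s u} :=
    convexHull_min (fun y hy => inner_le_supportFn hs hy)
      (convex_halfSpace_le (innerₛₗ ℝ u).isLinear _)
  exact hhalf hx

theorem supportFn_smul (hc : 0 ≤ c) (s : Set E) (u : E) :
    supportFn (c • s) u = c * supportFn s u := by
  rw [supportFn, supportFn, ← smul_eq_mul, ← Real.sSup_smul_of_nonneg hc,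
    Set.image_smul_comm _ _ _ fun x => real_inner_smul_right u x c]

theorem supportFn_add (hs : IsBounded s) (hsne : s.Nonempty) (ht : IsBounded t)
    (htne : t.Nonempty) (u : E) : supportFn (s + t) u = supportFn s u + supportFn t u := by
  have himage : inner ℝ u '' (s + t) = inner ℝ u '' s + inner ℝ u '' t :=
    Set.image_add (innerₛₗ ℝ u)
  rw [supportFn, himage]
  exact csSup_add (hsne.image _) (bddAbove_inner_image hs u) (htne.image _)
    (bddAbove_inner_image ht u)

theorem supportFn_le_supportFn_add_mul_norm (hs : IsBounded s) (hne : s.Nonempty)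
    (h : ∀ x ∈ s, ‖x‖ ≤ M) (u v : E) : supportFn s u ≤ supportFn s v + M * ‖u - v‖ := by
  refine supportFn_le hne fun x hx => ?_
  calc inner ℝ u x = inner ℝ v x + inner ℝ (u - v) x := by rw [inner_sub_left]; ring
    _ ≤ supportFn s v + ‖u - v‖ * ‖x‖ :=
        add_le_add (inner_le_supportFn hs hx) (real_inner_le_norm _ _)
    _ ≤ supportFn s v + M * ‖u - v‖ := by rw [mul_comm M]; gcongr; exact h x hx

theorem abs_supportFn_sub_le (hne : s.Nonempty) (h : s ⊆ closedBall 0 M) (u v : E) :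
    |supportFn s u - supportFn s v| ≤ M * ‖u - v‖ := by
  have hs : IsBounded s := isBounded_closedBall.subset h
  have hnorm : ∀ x ∈ s, ‖x‖ ≤ M := fun x hx => mem_closedBall_zero_iff.1 (h hx)
  have huv := supportFn_le_supportFn_add_mul_norm hs hne hnorm u v
  have hvu := supportFn_le_supportFn_add_mul_norm hs hne hnorm v u
  rw [norm_sub_rev] at hvu
  exact abs_le.2 ⟨by linarith, by linarith⟩

theorem abs_supportFn_le (hne : s.Nonempty) (h : s ⊆ closedBall 0 M) (u : E) :
    |supportFn s u| ≤ M * ‖u‖ := by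
  have hzero : supportFn s 0 = 0 := by
    simp only [supportFn, inner_zero_left, hne.image_const, csSup_singleton]
  simpa [hzero] using abs_supportFn_sub_le hne h u 0

theorem supportFn_le_supportFn_add_of_dist_le (hs : s.Nonempty) (ht : IsBounded t) {ε : ℝ}
    (h : ∀ x ∈ s, ∃ y ∈ t, dist x y ≤ ε) (u : E) :
    supportFn s u ≤ supportFn t u + ε * ‖u‖ := by
  refine supportFn_le hs fun x hx => ?_
  obtain ⟨y, hy, hxy⟩ := h x hx
  rw [dist_eq_norm] at hxy
  calc inner ℝ u x = inner ℝ u y + inner ℝ u (x - y) := by rw [inner_sub_right]; ring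
    _ ≤ supportFn t u + ‖u‖ * ‖x - y‖ :=
        add_le_add (inner_le_supportFn ht hy) (real_inner_le_norm _ _)
    _ ≤ supportFn t u + ε * ‖u‖ := by rw [mul_comm ‖u‖]; gcongr

theorem supportFn_le_supportFn_add_hausdorffDist (hs : IsBounded s) (hsne : s.Nonempty)
    (ht : IsCompact t) (htne : t.Nonempty) (u : E) :
    supportFn s u ≤ supportFn t u + hausdorffDist s t * ‖u‖ := by
  refine supportFn_le_supportFn_add_of_dist_le hsne ht.isBounded (fun x hx => ?_) u
  obtain ⟨y, hy, hxy⟩ := ht.exists_infDist_eq_dist htne x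
  exact ⟨y, hy, hxy ▸ infDist_le_hausdorffDist_of_mem hx
    (hausdorffEDist_ne_top_of_nonempty_of_bounded hsne htne hs ht.isBounded)⟩

theorem abs_supportFn_sub_le_hausdorffDist (hs : IsCompact s) (hsne : s.Nonempty)
    (ht : IsCompact t) (htne : t.Nonempty) (u : E) :
    |supportFn s u - supportFn t u| ≤ hausdorffDist s t * ‖u‖ := by
  have hst := supportFn_le_supportFn_add_hausdorffDist hs.isBounded hsne ht htne u
  have hts := supportFn_le_supportFn_add_hausdorffDist ht.isBounded htne hs hsne u
  rw [hausdorffDist_comm] at hts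
  exact abs_le.2 ⟨by linarith, by linarith⟩

theorem exists_dist_le_of_inner_le_supportFn {K : ConvexBody E} {ε : ℝ} (hε : 0 ≤ ε)
    (h : ∀ u : E, ‖u‖ = 1 → inner ℝ u x ≤ supportFn K u + ε) : ∃ y ∈ K, dist x y ≤ ε := by
  obtain ⟨y, hy, hmin⟩ :=
    exists_norm_eq_iInf_of_complete_convex K.nonempty K.isCompact.isComplete K.convex x
  rw [norm_eq_iInf_iff_real_inner_le_zero K.convex hy] at hmin
  refine ⟨y, hy, ?_⟩
  rw [dist_eq_norm]
  rcases eq_or_ne (x - y) 0 with hxy | hxy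
  · simpa [hxy] using hε
  have hpos : 0 < ‖x - y‖ := norm_pos_iff.2 hxy
  have hsupport : supportFn K (‖x - y‖⁻¹ • (x - y)) ≤ inner ℝ (‖x - y‖⁻¹ • (x - y)) y := by
    refine supportFn_le K.nonempty fun w hw => sub_nonpos.1 ?_
    rw [← inner_sub_right, real_inner_smul_left]
    exact mul_nonpos_of_nonneg_of_nonpos (by positivity) (hmin w hw)
  have hdist : inner ℝ (‖x - y‖⁻¹ • (x - y)) (x - y) = ‖x - y‖ := by
    rw [real_inner_smul_left, real_inner_self_eq_norm_mul_norm, inv_mul_cancel_left₀ hpos.ne']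
  rw [inner_sub_right] at hdist
  linarith [h (‖x - y‖⁻¹ • (x - y)) (norm_smul_inv_norm hxy)]

theorem mem_of_inner_le_supportFn {K : ConvexBody E} (h : ∀ u, inner ℝ u x ≤ supportFn K u) :
    x ∈ K := by
  obtain ⟨y, hy, hxy⟩ := exists_dist_le_of_inner_le_supportFn (K := K) le_rfl
    fun u _ => (h u).trans_eq (add_zero _).symm
  rwa [dist_le_zero.1 hxy]

theorem dist_le_of_abs_supportFn_sub_le {K L : ConvexBody E} {ε : ℝ} (hε : 0 ≤ ε)
    (h : ∀ u : E, ‖u‖ = 1 → |supportFn (K : Set E) u - supportFn L u| ≤ ε) : dist K L ≤ ε := by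
  rw [← ConvexBody.hausdorffDist_coe]
  refine hausdorffDist_le_of_mem_dist hε (fun x hx => ?_) fun x hx => ?_
  · refine exists_dist_le_of_inner_le_supportFn hε fun u hu => ?_
    linarith [(abs_le.1 (h u hu)).2, inner_le_supportFn (u := u) K.isBounded hx]
  · refine exists_dist_le_of_inner_le_supportFn hε fun u hu => ?_
    linarith [(abs_le.1 (h u hu)).1, inner_le_supportFn (u := u) L.isBounded hx]

theorem tendsto_supportFn {ι : Type*} {l : Filter ι} {K : ι → ConvexBody E} {D : ConvexBody E}
    (h : Tendsto K l (𝓝 D)) (u : E) :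
    Tendsto (fun i => supportFn (K i : Set E) u) l (𝓝 (supportFn D u)) := by
  refine tendsto_iff_dist_tendsto_zero.2 (squeeze_zero (fun _ => dist_nonneg) (fun i =>
    abs_supportFn_sub_le_hausdorffDist (K i).isCompact (K i).nonempty D.isCompact D.nonempty u) ?_)
  simpa using (tendsto_iff_dist_tendsto_zero.1 h).mul_const ‖u‖

variable [FiniteDimensional ℝ E]

theorem tendsto_dist_of_tendsto_supportFn_sub {ι : Type*} {l : Filter ι} {K L : ι → ConvexBody E}
    {Q : Set E} (hQ : Dense Q) (hK : ∀ i, (K i : Set E) ⊆ closedBall 0 M)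
    (hL : ∀ i, (L i : Set E) ⊆ closedBall 0 M)
    (h : ∀ q ∈ Q, Tendsto (fun i => supportFn (K i : Set E) q - supportFn (L i) q) l (𝓝 0)) :
    Tendsto (fun i => dist (K i) (L i)) l (𝓝 0) := by
  have : ProperSpace E := FiniteDimensional.proper ℝ E
  refine Metric.tendsto_nhds.2 fun ε hε => ?_
  obtain ⟨δ, hδ, hδM⟩ := exists_pos_mul_lt (show 0 < ε / 4 by positivity) |M|
  obtain ⟨F, hFQ, hF, hcover⟩ := (isCompact_sphere (0 : E) 1).elim_finite_subcover_image
    (b := Q) (c := fun q => ball q δ) (fun q _ => isOpen_ball) fun u _ =>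
      let ⟨q, hq, hqu⟩ := hQ.exists_dist_lt u hδ
      Set.mem_biUnion hq hqu
  have hev : ∀ᶠ i in l, ∀ q ∈ F, |supportFn (K i : Set E) q - supportFn (L i) q| < ε / 4 :=
    hF.eventually_all.2 fun q hq => by
      simpa using Metric.tendsto_nhds.1 (h q (hFQ hq)) (ε / 4) (by positivity)
  filter_upwards [hev] with i hi
  rw [Real.dist_0_eq_abs, abs_of_nonneg dist_nonneg]
  refine lt_of_le_of_lt (b := 3 * (ε / 4)) ?_ (by linarith)
  refine dist_le_of_abs_supportFn_sub_le (by positivity) fun u hu => ?_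
  obtain ⟨q, hq, huq⟩ := Set.mem_iUnion₂.1 (hcover (mem_sphere_zero_iff_norm.2 hu))
  have hMuq : M * ‖u - q‖ ≤ ε / 4 := calc
    M * ‖u - q‖ ≤ |M| * δ := by
      rw [← dist_eq_norm]
      exact mul_le_mul (le_abs_self M) huq.le dist_nonneg (abs_nonneg M)
    _ ≤ ε / 4 := hδM.le
  have hKuq := abs_le.1 (abs_supportFn_sub_le (K i).nonempty (hK i) u q)
  have hLuq := abs_le.1 (abs_supportFn_sub_le (L i).nonempty (hL i) u q)
  have hKL := abs_le.1 (hi q hq).le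
  exact abs_le.2 ⟨by linarith, by linarith⟩

theorem exists_tendsto_of_cauchySeq {K : ℕ → ConvexBody E} (hK : CauchySeq K) :
    ∃ D, Tendsto K atTop (𝓝 D) := by
  have : CompleteSpace E := FiniteDimensional.complete ℝ E
  let K' : ℕ → TopologicalSpace.NonemptyCompacts E :=
    fun i => ⟨⟨K i, (K i).isCompact⟩, (K i).nonempty⟩
  have hdist := cauchySeq_iff_tendsto_dist_atTop_0.1 hK
  have hK' : CauchySeq K' := cauchySeq_iff_tendsto_dist_atTop_0.2 hdist
  obtain ⟨D, hD⟩ := cauchySeq_tendsto_of_complete hK'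
  refine ⟨⟨convexHull ℝ D, convex_convexHull ℝ _, isCompact_convexHull D.isCompact,
    D.nonempty.convexHull⟩, tendsto_iff_dist_tendsto_zero.2 ?_⟩
  refine squeeze_zero (fun _ => dist_nonneg) (fun i => ?_) (tendsto_iff_dist_tendsto_zero.1 hD)
  refine dist_le_of_abs_supportFn_sub_le dist_nonneg fun u hu => ?_
  have := abs_supportFn_sub_le_hausdorffDist (K i).isCompact (K i).nonempty D.isCompact D.nonempty u
  rwa [hu, mul_one, ← supportFn_convexHull D.isCompact.isBounded D.nonempty] at this

theorem exists_ae_tendsto_of_tendsto_supportFn {Ω : Type*} [MeasurableSpace Ω] {P : Measure Ω}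
    [NeZero P] {K : ℕ → Ω → ConvexBody E} (hM : ∀ m ω, (K m ω : Set E) ⊆ closedBall 0 M)
    (h : ∀ u, ∃ c, ∀ᵐ ω ∂P, Tendsto (fun m => supportFn (K m ω : Set E) u) atTop (𝓝 c)) :
    ∃ D, ∀ᵐ ω ∂P, Tendsto (K · ω) atTop (𝓝 D) := by
  have : ProperSpace E := FiniteDimensional.proper ℝ E
  obtain ⟨Q, hQ_countable, hQ⟩ := TopologicalSpace.exists_countable_dense E
  choose c hc using h
  have hlim := (ae_ball_iff hQ_countable).2 fun q _ => hc q
  obtain ⟨ω₀, hω₀⟩ := hlim.exists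
  have hcauchy : CauchySeq (K · ω₀) := by
    refine cauchySeq_iff_tendsto_dist_atTop_0.2 (tendsto_dist_of_tendsto_supportFn_sub
      (K := fun p : ℕ × ℕ => K p.1 ω₀) (L := fun p : ℕ × ℕ => K p.2 ω₀) hQ
      (fun p => hM p.1 ω₀) (fun p => hM p.2 ω₀) fun q hq => ?_)
    rw [← sub_self (c q), ← prod_atTop_atTop_eq]
    exact ((hω₀ q hq).comp tendsto_fst).sub ((hω₀ q hq).comp tendsto_snd)
  obtain ⟨D, hD⟩ := exists_tendsto_of_cauchySeq hcauchy
  refine ⟨D, ?_⟩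
  filter_upwards [hlim] with ω hω
  refine (tendsto_iff_of_dist (tendsto_dist_of_tendsto_supportFn_sub hQ (hM · ω₀) (hM · ω)
    fun q hq => ?_)).1 hD
  simpa using (hω₀ q hq).sub (hω q hq)

end Convex

section ConvexBodies

open Metric

theorem subset_closedBall_of_tendsto {E : Type*} [NormedAddCommGroup E] [NormedSpace ℝ E]
    {ι : Type*} {l : Filter ι} [l.NeBot] {K : ι → ConvexBody E} {D : ConvexBody E} {r : ι → ℝ}
    {R : ℝ} (hK : ∀ i, (K i : Set E) ⊆ closedBall 0 (r i))
    (hD : Tendsto K l (𝓝 D)) (hr : Tendsto r l (𝓝 R)) : (D : Set E) ⊆ closedBall 0 R := by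
  intro x hx
  have hlim : Tendsto (fun i => r i + dist (K i) D) l (𝓝 R) := by
    simpa using hr.add (tendsto_iff_dist_tendsto_zero.1 hD)
  refine mem_closedBall_zero_iff.2 (ge_of_tendsto' hlim fun i => ?_)
  obtain ⟨y, hy, hxy⟩ := (K i).isCompact.exists_infDist_eq_dist (K i).nonempty x
  have hdist : dist x y ≤ dist (K i) D := by
    rw [← hxy, dist_comm, ← ConvexBody.hausdorffDist_coe]
    exact infDist_le_hausdorffDist_of_mem hx ConvexBody.hausdorffEDist_ne_top
  have hy' : ‖y‖ ≤ r i := mem_closedBall_zero_iff.1 (hK i hy)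
  rw [dist_eq_norm] at hdist
  linarith [norm_le_norm_add_norm_sub' x y]

variable {E : Type*} [NormedAddCommGroup E] [InnerProductSpace ℝ E] {D : ConvexBody E}

theorem subset_of_tendsto {ι : Type*} {l : Filter ι} [l.NeBot] {K : ι → ConvexBody E} {s : Set E}
    (hK : ∀ᶠ i in l, s ⊆ K i) (hD : Tendsto K l (𝓝 D)) : s ⊆ D := by
  refine fun x hx => mem_of_inner_le_supportFn fun u => ge_of_tendsto (tendsto_supportFn hD u) ?_
  filter_upwards [hK] with i hi using inner_le_supportFn (K i).isBounded (hi hx)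

theorem dist_smul_add_smul_le {c M : ℝ} {L : ConvexBody E} (hc : 0 ≤ c)
    (hL : (L : Set E) ⊆ closedBall 0 M) (K : ConvexBody E) :
    dist (c • (K + L)) (c • K) ≤ c * M := by
  obtain ⟨x, hx⟩ := L.nonempty
  have hM : 0 ≤ M := (norm_nonneg x).trans (mem_closedBall_zero_iff.1 (hL hx))
  refine dist_le_of_abs_supportFn_sub_le (by positivity) fun u hu => ?_
  have hLu := abs_supportFn_le L.nonempty hL u
  rw [hu, mul_one] at hLu
  rw [ConvexBody.coe_smul, ConvexBody.coe_smul, ConvexBody.coe_add, supportFn_smul hc,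
    supportFn_smul hc, supportFn_add K.isBounded K.nonempty L.isBounded L.nonempty, ← mul_sub,
    add_sub_cancel_left, abs_mul, abs_of_nonneg hc]
  gcongr

theorem tendsto_inv_smul_add_iff {K : ℕ → ConvexBody E} (L : ConvexBody E) :
    Tendsto (fun m : ℕ => (m : ℝ)⁻¹ • (K m + L)) atTop (𝓝 D) ↔
      Tendsto (fun m : ℕ => (m : ℝ)⁻¹ • K m) atTop (𝓝 D) := by
  obtain ⟨M, hM⟩ := L.isBounded.subset_closedBall 0
  refine tendsto_iff_of_dist (squeeze_zero (fun _ => dist_nonneg)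
    (fun m => dist_smul_add_smul_le (by positivity) hM (K m)) ?_)
  simpa using (tendsto_inv_atTop_nhds_zero_nat (𝕜 := ℝ)).mul_const M

end ConvexBodies

section Paths

theorem absolutelyContinuousOnInterval_lipschitzWith_comp {M N : Type*} [PseudoMetricSpace M]
    [PseudoMetricSpace N] {g : M → N} {γ : ℝ → M} {K : NNReal} {s t : ℝ} (hg : LipschitzWith K g)
    (hγ : AbsolutelyContinuousOnInterval γ s t) :
    AbsolutelyContinuousOnInterval (g ∘ γ) s t := by
  unfold AbsolutelyContinuousOnInterval at hγ ⊢
  refine squeeze_zero (fun I => Finset.sum_nonneg fun i _ => dist_nonneg) (fun I => ?_)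
    (by simpa using hγ.const_mul (K : ℝ))
  rw [Finset.mul_sum]
  exact Finset.sum_le_sum fun i _ => hg.dist_le_mul _ _

variable {E : Type*} [NormedAddCommGroup E]

/-- The integrated form of the speed constraint `‖γ' r‖ ≤ b (γ r) r` on `[s, t]`, which unlike the
differential form is preserved by uniform limits of paths. -/
def SpeedLE (b : E → ℝ → ℝ) (s t : ℝ) (γ : ℝ → E) : Prop :=
  ∀ r r', s ≤ r → r ≤ r' → r' ≤ t → ‖γ r' - γ r‖ ≤ ∫ u in r..r', b (γ u) u

variable {b : E → ℝ → ℝ} {s t m r r' α β : ℝ} {γ γ₁ γ₂ : ℝ → E}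

theorem SpeedLE.mono (h : SpeedLE b s t γ) {s' t' : ℝ} (hs : s ≤ s') (ht : t' ≤ t) :
    SpeedLE b s' t' γ :=
  fun r r' hr hrr' hr' => h r r' (hs.trans hr) hrr' (hr'.trans ht)

theorem SpeedLE.congr (h : SpeedLE b s t γ₁) (heq : Set.EqOn γ₁ γ₂ (Set.Icc s t)) :
    SpeedLE b s t γ₂ := by
  intro r r' hr hrr' hr'
  rw [← heq ⟨hr.trans hrr', hr'⟩, ← heq ⟨hr, hrr'.trans hr'⟩]
  refine (h r r' hr hrr' hr').trans_eq (intervalIntegral.integral_congr fun u hu => ?_)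
  rw [Set.uIcc_of_le hrr'] at hu
  rw [heq ⟨hr.trans hu.1, hu.2.trans hr'⟩]

theorem SpeedLE.norm_sub_le (h : SpeedLE b s t γ) (hβ : ∀ x r, ‖b x r‖ ≤ β) (hr : s ≤ r)
    (hrr' : r ≤ r') (hr' : r' ≤ t) : ‖γ r' - γ r‖ ≤ β * (r' - r) := calc
  ‖γ r' - γ r‖ ≤ ‖∫ u in r..r', b (γ u) u‖ := (h r r' hr hrr' hr').trans (Real.le_norm_self _)
  _ ≤ β * |r' - r| := intervalIntegral.norm_integral_le_of_norm_le_const fun u _ => hβ _ _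
  _ = β * (r' - r) := by rw [abs_of_nonneg (sub_nonneg.2 hrr')]

theorem SpeedLE.lipschitzOnWith (h : SpeedLE b s t γ) (hβ : ∀ x r, ‖b x r‖ ≤ β) :
    LipschitzOnWith β.toNNReal γ (Set.Icc s t) := by
  have hβ0 : 0 ≤ β := (norm_nonneg _).trans (hβ (γ s) s)
  refine LipschitzOnWith.of_dist_le_mul fun r hr r' hr' => ?_
  rw [Real.coe_toNNReal _ hβ0, Real.dist_eq, dist_eq_norm]
  rcases le_total r r' with hle | hle
  · rw [norm_sub_rev, abs_sub_comm, abs_of_nonneg (sub_nonneg.2 hle)]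
    exact h.norm_sub_le hβ hr.1 hle hr'.2
  · rw [abs_of_nonneg (sub_nonneg.2 hle)]
    exact h.norm_sub_le hβ hr'.1 hle hr.2

theorem SpeedLE.continuousOn_speed (h : SpeedLE b s t γ)
    (hb : Continuous fun p : E × ℝ => b p.1 p.2) (hβ : ∀ x r, ‖b x r‖ ≤ β) :
    ContinuousOn (fun u => b (γ u) u) (Set.Icc s t) :=
  hb.comp_continuousOn ((h.lipschitzOnWith hβ).continuousOn.prodMk continuousOn_id)

theorem SpeedLE.intervalIntegrable_speed (h : SpeedLE b s t γ)
    (hb : Continuous fun p : E × ℝ => b p.1 p.2) (hβ : ∀ x r, ‖b x r‖ ≤ β) (hr : s ≤ r)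
    (hrr' : r ≤ r') (hr' : r' ≤ t) : IntervalIntegrable (fun u => b (γ u) u) volume r r' :=
  ((h.continuousOn_speed hb hβ).mono (Set.Icc_subset_Icc hr hr')).intervalIntegrable_of_Icc hrr'

theorem SpeedLE.trans (h₁ : SpeedLE b s m γ) (h₂ : SpeedLE b m t γ)
    (hb : Continuous fun p : E × ℝ => b p.1 p.2) (hβ : ∀ x r, ‖b x r‖ ≤ β) :
    SpeedLE b s t γ := by
  intro r r' hr hrr' hr'
  rcases le_total r' m with hr'm | hmr'
  · exact h₁ r r' hr hrr' hr'm
  rcases le_total m r with hmr | hrm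
  · exact h₂ r r' hmr hrr' hr'
  calc ‖γ r' - γ r‖ ≤ ‖γ r' - γ m‖ + ‖γ m - γ r‖ := norm_sub_le_norm_sub_add_norm_sub _ _ _
    _ ≤ (∫ u in m..r', b (γ u) u) + ∫ u in r..m, b (γ u) u :=
        add_le_add (h₂ m r' le_rfl hmr' hr') (h₁ r m hr hrm le_rfl)
    _ = ∫ u in r..r', b (γ u) u := by
        rw [add_comm, intervalIntegral.integral_add_adjacent_intervals
          (h₁.intervalIntegrable_speed hb hβ hr hrm le_rfl)
          (h₂.intervalIntegrable_speed hb hβ le_rfl hmr' hr')]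

theorem SpeedLE.translate {b' : E → ℝ → ℝ} {l : E} (h : SpeedLE b s t γ)
    (hb' : ∀ x r, b' (x + l) (r + m) = b x r) :
    SpeedLE b' (s + m) (t + m) fun r => γ (r - m) + l := by
  intro r r' hr hrr' hr'
  have hspeed : ∀ u, b' (γ (u - m) + l) u = b (γ (u - m)) (u - m) := fun u => by
    rw [← hb', sub_add_cancel]
  simp only [hspeed, add_sub_add_right_eq_sub]
  rw [intervalIntegral.integral_comp_sub_right (fun u => b (γ u) u)]
  exact h (r - m) (r' - m) (by linarith) (by linarith) (by linarith)

theorem speedLE_add_smul [NormedSpace ℝ E] (hb : Continuous fun p : E × ℝ => b p.1 p.2)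
    (hα : ∀ x r, α ≤ b x r) {v : E} (hv : ‖v‖ ≤ α) (x : E) :
    SpeedLE b s t fun r => x + (r - s) • v := by
  intro r r' _ hrr' _
  calc ‖x + (r' - s) • v - (x + (r - s) • v)‖ = (r' - r) * ‖v‖ := by
        rw [add_sub_add_left_eq_sub, ← sub_smul, sub_sub_sub_cancel_right, norm_smul,
          Real.norm_of_nonneg (sub_nonneg.2 hrr')]
    _ ≤ (r' - r) * α := mul_le_mul_of_nonneg_left hv (sub_nonneg.2 hrr')
    _ = ∫ _ in r..r', α := by rw [intervalIntegral.integral_const, smul_eq_mul]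
    _ ≤ ∫ u in r..r', b (x + (u - s) • v) u :=
        intervalIntegral.integral_mono_on hrr' intervalIntegrable_const
          ((hb.comp (by fun_prop : Continuous fun u : ℝ =>
            (x + (u - s) • v, u))).intervalIntegrable _ _) fun u _ => hα _ _

theorem SpeedLE.norm_deriv_le [NormedSpace ℝ E] (h : SpeedLE b s t γ)
    (hb : Continuous fun p : E × ℝ => b p.1 p.2) (hβ : ∀ x r, ‖b x r‖ ≤ β)
    (hr : r ∈ Set.Ioo s t) (hd : DifferentiableAt ℝ γ r) : ‖deriv γ r‖ ≤ b (γ r) r := by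
  have hcont := (h.continuousOn_speed hb hβ).mono Set.Ioo_subset_Icc_self
  have hprimitive : HasDerivAt (fun p => ∫ u in r..p, b (γ u) u) (b (γ r) r) r :=
    intervalIntegral.integral_hasDerivAt_right IntervalIntegrable.refl
      (hcont.stronglyMeasurableAtFilter isOpen_Ioo r hr)
      (hcont.continuousAt (Ioo_mem_nhds hr.1 hr.2))
  have hlimγ := (hasDerivAt_iff_tendsto_slope.1 hd.hasDerivAt).mono_left (nhdsGT_le_nhdsNE r)
  have hlimb := (hasDerivAt_iff_tendsto_slope.1 hprimitive).mono_left (nhdsGT_le_nhdsNE r)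
  refine le_of_tendsto_of_tendsto hlimγ.norm hlimb ?_
  filter_upwards [Ioo_mem_nhdsGT hr.2] with p hp
  rw [slope_def_module, slope_def_module, norm_smul, norm_inv,
    Real.norm_of_nonneg (sub_nonneg.2 hp.1.le), intervalIntegral.integral_same, sub_zero,
    smul_eq_mul]
  exact mul_le_mul_of_nonneg_left (h r p hr.1.le hp.1.le hp.2.le)
    (inv_nonneg.2 (sub_nonneg.2 hp.1.le))

theorem norm_sub_le_integral_of_ae_norm_deriv_le [NormedSpace ℝ E] {g : ℝ → ℝ} (hst : s ≤ t)
    (hγ : AbsolutelyContinuousOnInterval γ s t) (hg : IntervalIntegrable g volume s t)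
    (hd : ∀ᵐ r, r ∈ Set.Icc s t → DifferentiableAt ℝ γ r ∧ ‖deriv γ r‖ ≤ g r) :
    ‖γ t - γ s‖ ≤ ∫ r in s..t, g r := by
  obtain ⟨φ, hφ, hφγ⟩ := exists_dual_vector'' ℝ (γ t - γ s)
  have hac := absolutelyContinuousOnInterval_lipschitzWith_comp φ.lipschitz hγ
  calc ‖γ t - γ s‖ = φ (γ t - γ s) := hφγ.symm
    _ = ∫ r in s..t, deriv (φ ∘ γ) r := by
        rw [hac.integral_deriv_eq_sub, map_sub, Function.comp_apply, Function.comp_apply]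
    _ ≤ ∫ r in s..t, g r := by
        refine intervalIntegral.integral_mono_ae_restrict hst hac.intervalIntegrable_deriv hg ?_
        filter_upwards [ae_restrict_of_ae hd, ae_restrict_mem measurableSet_Icc] with r hr hmem
        obtain ⟨hdr, hgr⟩ := hr hmem
        rw [(φ.hasFDerivAt.comp_hasDerivAt r hdr.hasDerivAt).deriv]
        exact (Real.le_norm_self _).trans
          ((φ.le_of_opNorm_le hφ _).trans (by rwa [one_mul]))

theorem speedLE_iff_ae_norm_deriv_le [NormedSpace ℝ E] [FiniteDimensional ℝ E]
    (hb : Continuous fun p : E × ℝ => b p.1 p.2) (hβ : ∀ x r, ‖b x r‖ ≤ β) (hst : s ≤ t) :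
    SpeedLE b s t γ ↔ AbsolutelyContinuousOnInterval γ s t ∧
      ∀ᵐ r, r ∈ Set.Icc s t → DifferentiableAt ℝ γ r ∧ ‖deriv γ r‖ ≤ b (γ r) r := by
  refine ⟨fun h => ⟨?_, ?_⟩, fun ⟨hγ, hd⟩ r r' hr hrr' hr' => ?_⟩
  · exact LipschitzOnWith.absolutelyContinuousOnInterval
      (by rw [Set.uIcc_of_le hst]; exact h.lipschitzOnWith hβ)
  · filter_upwards [(h.lipschitzOnWith hβ).ae_differentiableWithinAt_of_mem_real,
      Measure.ae_ne volume s, Measure.ae_ne volume t] with r hr hrs hrt hmem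
    have hIoo : r ∈ Set.Ioo s t := ⟨hmem.1.lt_of_ne' hrs, hmem.2.lt_of_ne hrt⟩
    have hdr := (hr hmem).differentiableAt (Icc_mem_nhds hIoo.1 hIoo.2)
    exact ⟨hdr, h.norm_deriv_le hb hβ hIoo hdr⟩
  · have hsub : Set.Icc r r' ⊆ Set.Icc s t := Set.Icc_subset_Icc hr hr'
    have hγ' := hγ.mono (by rwa [Set.uIcc_of_le hrr', Set.uIcc_of_le hst])
    refine norm_sub_le_integral_of_ae_norm_deriv_le hrr' hγ'
      (hb.comp_continuousOn (hγ'.continuousOn.prodMk continuousOn_id)).intervalIntegrable ?_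
    filter_upwards [hd] with u hu hmem using hu (hsub hmem)

/-- `y` can be reached at time `t` by a path that is at `x` at time `s` and obeys the speed bound
`b` in between. -/
def Reaches (b : E → ℝ → ℝ) (s t : ℝ) (x y : E) : Prop :=
  ∃ γ : ℝ → E, SpeedLE b s t γ ∧ γ s = x ∧ γ t = y

variable {x y z : E}

theorem Reaches.dist_le (h : Reaches b s t x y) (hβ : ∀ x r, ‖b x r‖ ≤ β) (hst : s ≤ t) :
    dist y x ≤ β * (t - s) := by
  obtain ⟨γ, hγ, rfl, rfl⟩ := h
  rw [dist_eq_norm]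
  exact hγ.norm_sub_le hβ le_rfl hst le_rfl

theorem Reaches.trans (hxy : Reaches b s m x y) (hyz : Reaches b m t y z)
    (hb : Continuous fun p : E × ℝ => b p.1 p.2) (hβ : ∀ x r, ‖b x r‖ ≤ β) (hsm : s ≤ m)
    (hmt : m ≤ t) : Reaches b s t x z := by
  obtain ⟨γ₁, hγ₁, rfl, rfl⟩ := hxy
  obtain ⟨γ₂, hγ₂, hjoin, rfl⟩ := hyz
  have heq₁ : Set.EqOn γ₁ (fun r => if r ≤ m then γ₁ r else γ₂ r) (Set.Icc s m) :=
    fun r hr => (if_pos hr.2).symm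
  have heq₂ : Set.EqOn γ₂ (fun r => if r ≤ m then γ₁ r else γ₂ r) (Set.Icc m t) := by
    intro r hr
    rcases hr.1.eq_or_lt with rfl | hlt
    · simp only [le_refl, if_true, hjoin]
    · simp only [hlt.not_ge, if_false]
  exact ⟨_, (hγ₁.congr heq₁).trans (hγ₂.congr heq₂) hb hβ, (heq₁ ⟨le_rfl, hsm⟩).symm,
    (heq₂ ⟨hmt, le_rfl⟩).symm⟩

theorem Reaches.exists_between (h : Reaches b s t x z) (hsm : s ≤ m) (hmt : m ≤ t) :
    ∃ y, Reaches b s m x y ∧ Reaches b m t y z := by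
  obtain ⟨γ, hγ, rfl, rfl⟩ := h
  exact ⟨γ m, ⟨γ, hγ.mono le_rfl hmt, rfl, rfl⟩, ⟨γ, hγ.mono hsm le_rfl, rfl, rfl⟩⟩

theorem Reaches.translate {b' : E → ℝ → ℝ} {l : E} (h : Reaches b s t x y)
    (hb' : ∀ x r, b' (x + l) (r + m) = b x r) :
    Reaches b' (s + m) (t + m) (x + l) (y + l) := by
  obtain ⟨γ, hγ, rfl, rfl⟩ := h
  exact ⟨_, hγ.translate hb', by simp, by simp⟩

theorem reaches_of_dist_le [NormedSpace ℝ E] (hb : Continuous fun p : E × ℝ => b p.1 p.2)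
    (hα0 : 0 ≤ α) (hα : ∀ x r, α ≤ b x r) (hst : s ≤ t) (hxy : dist y x ≤ α * (t - s)) :
    Reaches b s t x y := by
  have hv : ‖(t - s)⁻¹ • (y - x)‖ ≤ α := by
    rw [norm_smul, norm_inv, Real.norm_of_nonneg (sub_nonneg.2 hst), ← dist_eq_norm,
      ← div_eq_inv_mul]
    exact div_le_of_le_mul₀ (sub_nonneg.2 hst) hα0 hxy
  refine ⟨_, speedLE_add_smul hb hα hv x, by simp, ?_⟩
  rcases hst.eq_or_lt with rfl | hlt
  · simpa [eq_comm, dist_eq_norm, sub_eq_zero] using hxy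
  · simp [smul_smul, (sub_pos.2 hlt).ne']

/-- The points that are reached at time `t` from the points of `S` at time `s`. -/
def reachSet (b : E → ℝ → ℝ) (s t : ℝ) (S : Set E) : Set E :=
  {y | ∃ x ∈ S, Reaches b s t x y}

variable {S : Set E}

theorem subset_reachSet [NormedSpace ℝ E] (hb : Continuous fun p : E × ℝ => b p.1 p.2)
    (h0 : ∀ x r, 0 ≤ b x r) (hst : s ≤ t) : S ⊆ reachSet b s t S :=
  fun x hx => ⟨x, hx, reaches_of_dist_le hb le_rfl h0 hst (by simp)⟩

end Paths

section Compactness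

theorem exists_forall_le_zero_iff {X ι : Type*} [TopologicalSpace X] [CompactSpace X] {D : Set X}
    {ψ : ι → X → ℝ} (hD : Dense D) (hψ : ∀ i, Continuous (ψ i)) :
    (∃ x, ∀ i, ψ i x ≤ 0) ↔
      ∀ p : Finset ι × ℕ, ∃ x ∈ D, ∀ i ∈ p.1, ψ i x < 1 / ((p.2 : ℝ) + 1) := by
  classical
  constructor
  · rintro ⟨x, hx⟩ ⟨F, j⟩
    have hopen : IsOpen {y | ∀ i ∈ F, ψ i y < 1 / ((j : ℝ) + 1)} := by
      simp only [Set.ofPred_forall]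
      exact isOpen_biInter_finset fun i _ => isOpen_lt (hψ i) continuous_const
    obtain ⟨y, hyD, hy⟩ := hD.exists_mem_open hopen
      ⟨x, fun i _ => (hx i).trans_lt Nat.one_div_pos_of_nat⟩
    exact ⟨y, hyD, hy⟩
  · intro h
    let C : Finset ι × ℕ → Set X := fun p => ⋂ i ∈ p.1, {x | ψ i x ≤ 1 / ((p.2 : ℝ) + 1)}
    have hclosed : ∀ p, IsClosed (C p) := fun p =>
      isClosed_biInter fun i _ => isClosed_le (hψ i) continuous_const
    have hanti : Antitone C := fun p q hpq x hx => Set.mem_iInter₂.2 fun i hi =>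
      (show ψ i x ≤ _ from Set.mem_iInter₂.1 hx i (hpq.1 hi)).trans (Nat.one_div_le_one_div hpq.2)
    have hnonempty : ∀ p, (C p).Nonempty := fun p =>
      let ⟨x, _, hx⟩ := h p
      ⟨x, Set.mem_iInter₂.2 fun i hi => (hx i hi).le⟩
    obtain ⟨x, hx⟩ := IsCompact.nonempty_iInter_of_directed_nonempty_isCompact_isClosed C
      hanti.directed_ge hnonempty (fun p => (hclosed p).isCompact) hclosed
    refine ⟨x, fun i => ge_of_tendsto' tendsto_one_div_add_atTop_nhds_zero_nat fun j => ?_⟩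
    exact Set.mem_iInter₂.1 (Set.mem_iInter.1 hx ({i}, j)) i (Finset.mem_singleton_self i)

variable {E : Type*} [NormedAddCommGroup E] {b : E → ℝ → ℝ} {s t β : ℝ} {S : Set E}

/-- The `K`-Lipschitz curves `ℝ → E` that are in `S` at time `s`. -/
def lipCurves (S : Set E) (s : ℝ) (K : NNReal) : Set C(ℝ, E) :=
  {γ | γ s ∈ S ∧ LipschitzWith K γ}

theorem isCompact_lipCurves [ProperSpace E] (hS : IsCompact S) (s : ℝ) (K : NNReal) :
    IsCompact (lipCurves S s K) := by
  refine ArzelaAscoli.isCompact_of_equicontinuous _ ?_ (LipschitzWith.uniformEquicontinuous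
    (fun γ : lipCurves S s K => (γ : ℝ → E)) K fun γ => γ.2.2).equicontinuous
  have himage : ContinuousMap.toFun '' lipCurves S s K = {f | f s ∈ S ∧ LipschitzWith K f} := by
    ext f
    exact ⟨fun ⟨_, hγ, hf⟩ => hf ▸ hγ, fun hf => ⟨⟨f, hf.2.continuous⟩, hf, rfl⟩⟩
  obtain ⟨M, hM⟩ := hS.isBounded.subset_closedBall 0
  rw [himage]
  refine (isCompact_univ_pi fun r : ℝ =>
    isCompact_closedBall (0 : E) (K * dist r s + M)).of_isClosed_subset
    ((hS.isClosed.preimage (continuous_apply s)).inter (isClosed_setOfPred_lipschitzWith K)) ?_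
  intro f hf r _
  exact (dist_triangle _ (f s) _).trans (add_le_add (hf.2.dist_le_mul r s) (hM hf.1))

/-- The excess of the displacement of `γ` between the times `p.1` and `p.2` over the one which the
speed bound `b` allows. -/
noncomputable def speedExcess (b : E → ℝ → ℝ) (γ : ℝ → E) (p : ℝ × ℝ) : ℝ :=
  ‖γ p.2 - γ p.1‖ - ∫ u in p.1..p.2, b (γ u) u

theorem speedLE_iff_speedExcess_le_zero {γ : ℝ → E} :
    SpeedLE b s t γ ↔
      ∀ p : {p : ℝ × ℝ // s ≤ p.1 ∧ p.1 ≤ p.2 ∧ p.2 ≤ t}, speedExcess b γ p ≤ 0 := by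
  simp only [SpeedLE, speedExcess, sub_nonpos, Subtype.forall, Prod.forall, and_imp]

theorem continuous_speedExcess (hb : Continuous fun p : E × ℝ => b p.1 p.2) (γ : C(ℝ, E)) :
    Continuous (speedExcess b γ) := by
  have hint : ∀ r r', IntervalIntegrable (fun u => b (γ u) u) volume r r' := fun r r' =>
    (hb.comp (γ.continuous.prodMk continuous_id)).intervalIntegrable r r'
  have hprimitive : Continuous fun r => ∫ u in (0 : ℝ)..r, b (γ u) u :=
    intervalIntegral.continuous_primitive hint 0
  have hexcess : speedExcess b γ = fun p => ‖γ p.2 - γ p.1‖ -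
      ((∫ u in (0 : ℝ)..p.2, b (γ u) u) - ∫ u in (0 : ℝ)..p.1, b (γ u) u) := by
    ext p
    rw [intervalIntegral.integral_interval_sub_left (hint _ _) (hint _ _), speedExcess]
  rw [hexcess]
  exact Continuous.sub (by fun_prop)
    ((hprimitive.comp continuous_snd).sub (hprimitive.comp continuous_fst))

theorem continuous_speedExcess_curve [SecondCountableTopology E]
    (hb : Continuous fun p : E × ℝ => b p.1 p.2) (hβ : ∀ x r, ‖b x r‖ ≤ β) (p : ℝ × ℝ) :
    Continuous fun γ : C(ℝ, E) => speedExcess b γ p := by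
  refine Continuous.sub (by fun_prop) ?_
  refine intervalIntegral.continuous_of_dominated_interval (bound := fun _ => β)
    (fun γ => ?_) (fun γ => ae_of_all _ fun u _ => hβ _ _) intervalIntegrable_const
    (ae_of_all _ fun u _ => hb.comp ((continuous_eval_const u).prodMk continuous_const))
  exact (hb.comp (γ.continuous.prodMk continuous_id)).aestronglyMeasurable

theorem isClosed_setOf_speedLE [SecondCountableTopology E]
    (hb : Continuous fun p : E × ℝ => b p.1 p.2) (hβ : ∀ x r, ‖b x r‖ ≤ β) :
    IsClosed {γ : C(ℝ, E) | SpeedLE b s t γ} := by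
  simp only [speedLE_iff_speedExcess_le_zero, Set.ofPred_forall]
  exact isClosed_iInter fun p =>
    isClosed_le (continuous_speedExcess_curve hb hβ p) continuous_const

theorem SpeedLE.exists_lipschitzWith_eqOn {γ : ℝ → E} (h : SpeedLE b s t γ)
    (hβ : ∀ x r, ‖b x r‖ ≤ β) (hst : s ≤ t) :
    ∃ γ' : C(ℝ, E), LipschitzWith β.toNNReal γ' ∧ Set.EqOn γ γ' (Set.Icc s t) := by
  have hlip : LipschitzWith β.toNNReal (Set.IccExtend hst ((Set.Icc s t).domRestrict γ)) := by
    have := (h.lipschitzOnWith hβ).to_restrict.comp (LipschitzWith.projIcc hst)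
    rwa [mul_one] at this
  exact ⟨⟨_, hlip.continuous⟩, hlip, fun r hr =>
    (Set.IccExtend_of_mem hst ((Set.Icc s t).domRestrict γ) hr).symm⟩

theorem reachSet_eq_image_lipCurves (hβ : ∀ x r, ‖b x r‖ ≤ β) (hst : s ≤ t) (S : Set E) :
    reachSet b s t S = (fun γ : C(ℝ, E) => γ t) ''
      (lipCurves S s β.toNNReal ∩ {γ | SpeedLE b s t γ}) := by
  ext y
  constructor
  · rintro ⟨_, hx, γ, hγ, rfl, rfl⟩
    obtain ⟨γ', hlip, heq⟩ := hγ.exists_lipschitzWith_eqOn hβ hst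
    exact ⟨γ', ⟨⟨heq ⟨le_rfl, hst⟩ ▸ hx, hlip⟩, hγ.congr heq⟩, (heq ⟨hst, le_rfl⟩).symm⟩
  · rintro ⟨γ, ⟨hγS, hγ⟩, rfl⟩
    exact ⟨_, hγS.1, γ, hγ, rfl, rfl⟩

theorem isCompact_reachSet [ProperSpace E] (hb : Continuous fun p : E × ℝ => b p.1 p.2)
    (hβ : ∀ x r, ‖b x r‖ ≤ β) (hst : s ≤ t) (hS : IsCompact S) : IsCompact (reachSet b s t S) := by
  rw [reachSet_eq_image_lipCurves hβ hst]
  exact ((isCompact_lipCurves hS s _).inter_right (isClosed_setOf_speedLE hb hβ)).image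
    (continuous_eval_const t)

end Compactness

section Measurability

variable {Ω : Type*} [MeasurableSpace Ω]

theorem measurableSet_exists_forall_le_zero {X ι : Type*} [TopologicalSpace X] [CompactSpace X]
    [TopologicalSpace.SeparableSpace X] [TopologicalSpace ι] [TopologicalSpace.SeparableSpace ι]
    {ψ : ι → X → Ω → ℝ} (hψX : ∀ i ω, Continuous fun x => ψ i x ω)
    (hψι : ∀ x ω, Continuous fun i => ψ i x ω) (hψΩ : ∀ i x, Measurable (ψ i x)) :
    MeasurableSet {ω | ∃ x, ∀ i, ψ i x ω ≤ 0} := by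
  obtain ⟨D, hD_countable, hD⟩ := TopologicalSpace.exists_countable_dense X
  obtain ⟨J, hJ_countable, hJ⟩ := TopologicalSpace.exists_countable_dense ι
  have : Countable J := hJ_countable
  have hJ_iff : ∀ x ω, (∀ i, ψ i x ω ≤ 0) ↔ ∀ i : J, ψ i x ω ≤ 0 := fun x ω =>
    ⟨fun h i => h i, fun h i => (isClosed_le (hψι x ω) continuous_const).closure_subset_iff.2
      (fun j hj => h ⟨j, hj⟩) (hJ i)⟩
  have hcountable : {ω | ∃ x, ∀ i, ψ i x ω ≤ 0} = ⋂ p : Finset J × ℕ, ⋃ x ∈ D, ⋂ i ∈ p.1,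
      {ω | ψ i x ω < 1 / ((p.2 : ℝ) + 1)} := by
    ext ω
    simp only [Set.mem_ofPred_eq, hJ_iff, exists_forall_le_zero_iff hD fun i : J => hψX i ω,
      Set.mem_iInter, Set.mem_iUnion, exists_prop]
  rw [hcountable]
  exact .iInter fun p => .biUnion hD_countable fun x _ =>
    .biInter p.1.countable_toSet fun i _ => measurableSet_lt (hψΩ i x) measurable_const

variable {E : Type*} [NormedAddCommGroup E] {a : E → ℝ → Ω → ℝ} {s t β : ℝ} {S : Set E}

theorem measurable_speedExcess [MeasurableSpace E] [BorelSpace E]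
    [SecondCountableTopology E]
    (hmeas : Measurable fun p : (E × ℝ) × Ω => a p.1.1 p.1.2 p.2) (γ : C(ℝ, E)) (p : ℝ × ℝ) :
    Measurable fun ω => speedExcess (a · · ω) γ p := by
  have hspeed : StronglyMeasurable fun q : Ω × ℝ => a (γ q.2) q.2 q.1 :=
    (hmeas.comp (by fun_prop : Measurable fun q : Ω × ℝ =>
      ((γ q.2, q.2), q.1))).stronglyMeasurable
  refine measurable_const.sub ?_
  simp only [intervalIntegral]
  exact hspeed.integral_prod_right'.measurable.sub hspeed.integral_prod_right'.measurable

theorem measurable_supportFn_reachSet [InnerProductSpace ℝ E] [ProperSpace E] [MeasurableSpace E]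
    [BorelSpace E] (hmeas : Measurable fun p : (E × ℝ) × Ω => a p.1.1 p.1.2 p.2)
    (hcont : ∀ ω, Continuous fun p : E × ℝ => a p.1 p.2 ω) (h0 : ∀ x r ω, 0 ≤ a x r ω)
    (hβ : ∀ x r ω, ‖a x r ω‖ ≤ β) (hst : s ≤ t) (hS : IsCompact S) (hne : S.Nonempty) (u : E) :
    Measurable fun ω => supportFn (reachSet (a · · ω) s t S) u := by
  refine measurable_of_Ici fun c => ?_
  let K := lipCurves S s β.toNNReal ∩ {γ | c ≤ inner ℝ u (γ t)}
  have : CompactSpace K := isCompact_iff_compactSpace.1 <| (isCompact_lipCurves hS s _).inter_right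
    (isClosed_le continuous_const (continuous_const.inner (continuous_eval_const t)))
  have hpreimage : (fun ω => supportFn (reachSet (a · · ω) s t S) u) ⁻¹' Set.Ici c =
      {ω | ∃ γ : K, ∀ p : {p : ℝ × ℝ // s ≤ p.1 ∧ p.1 ≤ p.2 ∧ p.2 ≤ t},
        speedExcess (a · · ω) γ.1 p ≤ 0} := by
    ext ω
    rw [Set.mem_preimage, Set.mem_Ici, le_supportFn_iff
      (isCompact_reachSet (hcont ω) (hβ · · ω) hst hS)
      (hne.mono (subset_reachSet (hcont ω) (h0 · · ω) hst)),
      reachSet_eq_image_lipCurves (hβ · · ω) hst, Set.exists_mem_image]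
    simp only [Set.mem_ofPred_eq, ← speedLE_iff_speedExcess_le_zero, Subtype.exists, K,
      Set.mem_inter_iff, exists_prop]
    exact exists_congr fun γ => by rw [and_right_comm]
  rw [hpreimage]
  exact measurableSet_exists_forall_le_zero
    (fun p ω => (continuous_speedExcess_curve (hcont ω) (hβ · · ω) p).comp continuous_subtype_val)
    (fun γ ω => (continuous_speedExcess (hcont ω) γ.1).comp continuous_subtype_val)
    fun p γ => measurable_speedExcess hmeas γ.1 p

end Measurability

section AlmostAdditivity

open Metric

variable {E : Type*} [NormedAddCommGroup E] {b b' : E → ℝ → ℝ} {L S : Set E} {s t m k α β δ : ℝ}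
  {x y z : E}

theorem reachSet_subset_closedBall (hβ : ∀ x r, ‖b x r‖ ≤ β) (hst : s ≤ t)
    (hS : S ⊆ closedBall 0 δ) : reachSet b s t S ⊆ closedBall 0 (δ + β * (t - s)) := by
  rintro y ⟨x, hx, hxy⟩
  rw [mem_closedBall, add_comm]
  exact (dist_triangle y x 0).trans (add_le_add (hxy.dist_le hβ hst) (hS hx))

theorem isBounded_reachSet (hβ : ∀ x r, ‖b x r‖ ≤ β) (hst : s ≤ t) (hS : Bornology.IsBounded S) :
    Bornology.IsBounded (reachSet b s t S) :=
  let ⟨_, hδ⟩ := hS.subset_closedBall 0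
  isBounded_closedBall.subset (reachSet_subset_closedBall hβ hst hδ)

theorem reachSet_add_subset (hS : ∀ x, ∃ l ∈ L, x - l ∈ S)
    (hb' : ∀ l ∈ L, ∀ x r, b (x + l) (r + m) = b' x r) (hm : 0 ≤ m) (hk : 0 ≤ k) :
    reachSet b 0 (m + k) S ⊆ reachSet b 0 m S + reachSet b' 0 k S - S := by
  rintro y ⟨w, hw, hwy⟩
  obtain ⟨x, hwx, hxy⟩ := hwy.exists_between hm (le_add_of_nonneg_right hk)
  obtain ⟨l, hl, hxl⟩ := hS x
  have htranslate := hxy.translate (b' := b') (l := -l) (m := -m) fun x r => by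
    rw [← hb' l hl, neg_add_cancel_right, neg_add_cancel_right]
  rw [add_neg_cancel, add_neg_cancel_comm, ← sub_eq_add_neg, ← sub_eq_add_neg] at htranslate
  exact ⟨x + (y - l), Set.add_mem_add ⟨w, hw, hwx⟩ ⟨x - l, hxl, htranslate⟩, x - l, hxl, by
    dsimp only; abel⟩

/-- If the second path lasts longer than `δ / α`, it is joined after that delay, which is the time
needed to steer at speed `α` from `x` to a lattice translate of the path. -/
theorem exists_mem_reachSet_add_dist_le [NormedSpace ℝ E]
    (hb : Continuous fun p : E × ℝ => b p.1 p.2) (hα0 : 0 < α) (hα : ∀ x r, α ≤ b x r)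
    (hβ : ∀ x r, ‖b x r‖ ≤ β)
    (hβ' : ∀ x r, ‖b' x r‖ ≤ β) (hSδ : S ⊆ closedBall 0 δ) (hS : ∀ x, ∃ l ∈ L, x - l ∈ S)
    (hb' : ∀ l ∈ L, ∀ x r, b (x + l) (r + m) = b' x r) (hm : 0 ≤ m) (hk : 0 ≤ k)
    (hx : x ∈ reachSet b 0 m S) (hz : z ∈ reachSet b' 0 k S) :
    ∃ y ∈ reachSet b 0 (m + k) S, dist (x + z) y ≤ 2 * δ + β * (δ / α) := by
  obtain ⟨v, hv, hvx⟩ := hx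
  have hδ : 0 ≤ δ := nonempty_closedBall.1 ⟨v, hSδ hv⟩
  have hβ0 : 0 ≤ β := (norm_nonneg _).trans (hβ 0 0)
  rcases le_total (δ / α) k with hδk | hkδ
  · obtain ⟨v', hv', hv'z⟩ := hz
    obtain ⟨w, hv'w, hwz⟩ := hv'z.exists_between (by positivity) hδk
    obtain ⟨l, hl, hxwl⟩ := hS (x - w)
    have hwδ : ‖w‖ ≤ δ + β * (δ / α) := by
      simpa using reachSet_subset_closedBall hβ' (by positivity) hSδ ⟨v', hv', hv'w⟩
    have hxwlδ : ‖x - w - l‖ ≤ δ := mem_closedBall_zero_iff.1 (hSδ hxwl)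
    have hsteer : Reaches b m (δ / α + m) x (w + l) := by
      refine reaches_of_dist_le hb hα0.le hα (le_add_of_nonneg_left (by positivity)) ?_
      rwa [add_sub_cancel_right, mul_div_cancel₀ _ hα0.ne', dist_comm, dist_eq_norm, ← sub_sub]
    have hjoin : Reaches b m (m + k) x (z + l) := by
      rw [add_comm m k]
      exact hsteer.trans (hwz.translate (hb' l hl)) hb hβ
        (le_add_of_nonneg_left (by positivity)) (add_le_add_left hδk m)
    refine ⟨z + l, ⟨v, hv, hvx.trans hjoin hb hβ hm (le_add_of_nonneg_right hk)⟩, ?_⟩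
    calc dist (x + z) (z + l) = ‖x - w - l + w‖ := by rw [dist_eq_norm]; congr 1; abel
      _ ≤ ‖x - w - l‖ + ‖w‖ := norm_add_le _ _
      _ ≤ 2 * δ + β * (δ / α) := by linarith
  · have hstay : Reaches b m (m + k) x x :=
      reaches_of_dist_le hb hα0.le hα (le_add_of_nonneg_right hk) 
        (by rw [dist_self]; exact mul_nonneg hα0.le (by linarith))
    refine ⟨x, ⟨v, hv, hvx.trans hstay hb hβ hm (le_add_of_nonneg_right hk)⟩, ?_⟩
    have hzδ : ‖z‖ ≤ δ + β * k := by simpa using reachSet_subset_closedBall hβ' hk hSδ hz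
    rw [dist_self_add_left]
    linarith [mul_le_mul_of_nonneg_left hkδ hβ0]

theorem abs_supportFn_reachSet_add_sub_sub_le [InnerProductSpace ℝ E]
    (hb : Continuous fun p : E × ℝ => b p.1 p.2) (hbc' : Continuous fun p : E × ℝ => b' p.1 p.2)
    (hα0 : 0 < α) (hα : ∀ x r, α ≤ b x r) (hα' : ∀ x r, α ≤ b' x r) (hβ : ∀ x r, ‖b x r‖ ≤ β)
    (hβ' : ∀ x r, ‖b' x r‖ ≤ β) (hSδ : S ⊆ closedBall 0 δ) (hS : ∀ x, ∃ l ∈ L, x - l ∈ S)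
    (hb' : ∀ l ∈ L, ∀ x r, b (x + l) (r + m) = b' x r) (hm : 0 ≤ m) (hk : 0 ≤ k) (u : E) :
    |supportFn (reachSet b 0 (m + k) S) u - supportFn (reachSet b 0 m S) u -
      supportFn (reachSet b' 0 k S) u| ≤ (2 * δ + β * (δ / α)) * ‖u‖ := by
  have hSbdd : Bornology.IsBounded S := isBounded_closedBall.subset hSδ
  have hSne : S.Nonempty := let ⟨l, _, hl⟩ := hS 0; ⟨_, hl⟩
  have hδ : 0 ≤ δ := nonempty_closedBall.1 (hSne.mono hSδ)
  have hβ0 : 0 ≤ β := (norm_nonneg _).trans (hβ 0 0)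
  have hmk : 0 ≤ m + k := add_nonneg hm hk
  have hne : (reachSet b 0 m S).Nonempty :=
    hSne.mono (subset_reachSet hb (hα0.le.trans <| hα · ·) hm)
  have hne' : (reachSet b' 0 k S).Nonempty :=
    hSne.mono (subset_reachSet hbc' (hα0.le.trans <| hα' · ·) hk)
  have hne_add : (reachSet b 0 (m + k) S).Nonempty :=
    hSne.mono (subset_reachSet hb (hα0.le.trans <| hα · ·) hmk)
  have hbdd := isBounded_reachSet hβ hm hSbdd
  have hbdd' := isBounded_reachSet hβ' hk hSbdd
  have hle : supportFn (reachSet b 0 (m + k) S) u ≤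
      supportFn (reachSet b 0 m S + reachSet b' 0 k S) u + δ * ‖u‖ := by
    refine supportFn_le_supportFn_add_of_dist_le hne_add (hbdd.add hbdd') (fun y hy => ?_) u
    obtain ⟨w, hw, e, he, rfl⟩ := reachSet_add_subset hS hb' hm hk hy
    exact ⟨w, hw, by simpa [dist_eq_norm] using hSδ he⟩
  have hge : supportFn (reachSet b 0 m S + reachSet b' 0 k S) u ≤
      supportFn (reachSet b 0 (m + k) S) u + (2 * δ + β * (δ / α)) * ‖u‖ := by
    refine supportFn_le_supportFn_add_of_dist_le (hne.add hne')
      (isBounded_reachSet hβ hmk hSbdd) (fun w hw => ?_) u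
    obtain ⟨x, hx, z, hz, rfl⟩ := hw
    exact exists_mem_reachSet_add_dist_le hb hα0 hα hβ hβ' hSδ hS hb' hm hk hx hz
  rw [supportFn_add hbdd hne hbdd' hne'] at hle hge
  have hδu : 0 ≤ (δ + β * (δ / α)) * ‖u‖ := by positivity
  exact abs_le.2 ⟨by linarith, by linarith⟩

end AlmostAdditivity

section UnitCell

variable {n : ℕ}

theorem isCompact_unitCell (n : ℕ) : IsCompact (unitCell n) := by
  have hpreimage : unitCell n = WithLp.ofLp ⁻¹' Set.univ.pi fun _ : Fin n => Set.Icc (0 : ℝ) 1 := by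
    ext x
    simp [unitCell, Pi.le_def, forall_and]
  rw [hpreimage]
  exact (PiLp.homeomorph 2 fun _ : Fin n => ℝ).isCompact_preimage.2
    (isCompact_univ_pi fun _ => isCompact_Icc)

theorem convex_unitCell (n : ℕ) : Convex ℝ (unitCell n) :=
  fun _ hx _ hy _ _ hc hd hcd i => convex_Icc (0 : ℝ) 1 (hx i) (hy i) hc hd hcd

theorem zero_mem_unitCell (n : ℕ) : (0 : EuclideanSpace ℝ (Fin n)) ∈ unitCell n :=
  fun _ => ⟨le_rfl, zero_le_one⟩

theorem unitCell_subset_closedBall (n : ℕ) : unitCell n ⊆ Metric.closedBall 0 √n := by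
  intro x hx
  rw [mem_closedBall_zero_iff, EuclideanSpace.norm_eq]
  refine Real.sqrt_le_sqrt ((Finset.sum_le_sum fun i _ => ?_).trans
    (by simp : ∑ _i : Fin n, (1 : ℝ) ≤ n))
  rw [Real.norm_of_nonneg (hx i).1]
  exact pow_le_one₀ (hx i).1 (hx i).2

/-- The lattice `ℤⁿ` of spatial periods. -/
def integerLattice (n : ℕ) : Set (EuclideanSpace ℝ (Fin n)) :=
  {l | ∀ i, ∃ z : ℤ, l i = z}

theorem exists_integerLattice_sub_mem_unitCell (x : EuclideanSpace ℝ (Fin n)) :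
    ∃ l ∈ integerLattice n, x - l ∈ unitCell n :=
  ⟨WithLp.toLp 2 fun i => (⌊x i⌋ : ℝ), fun i => ⟨⌊x i⌋, rfl⟩, fun i =>
    ⟨Int.fract_nonneg (x i), (Int.fract_lt_one (x i)).le⟩⟩

/-- The convex body `-Y`, the reflected unit cell. -/
def negUnitCell (n : ℕ) : ConvexBody (EuclideanSpace ℝ (Fin n)) :=
  ⟨-unitCell n, (convex_unitCell n).neg, (isCompact_unitCell n).neg,
    Set.Nonempty.neg ⟨0, zero_mem_unitCell n⟩⟩

theorem reachY_eq_reachSet {Ω : Type*} {a : EuclideanSpace ℝ (Fin n) → ℝ → Ω → ℝ} {β t : ℝ} {ω : Ω}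
    (ha : Continuous fun p : EuclideanSpace ℝ (Fin n) × ℝ => a p.1 p.2 ω)
    (hβ : ∀ x r, ‖a x r ω‖ ≤ β) (ht : 0 ≤ t) :
    reachY a t ω = reachSet (a · · ω) 0 t (unitCell n) := by
  ext y
  simp only [reachY, reach, admissible, reachSet, Reaches, Set.mem_iUnion, Set.mem_ofPred_eq,
    exists_prop, speedLE_iff_ae_norm_deriv_le ha hβ ht]

theorem tendstoHausdorff_coe {K : ℕ → ConvexBody (EuclideanSpace ℝ (Fin n))}
    {D : ConvexBody (EuclideanSpace ℝ (Fin n))} (h : Tendsto K atTop (𝓝 D)) :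
    TendstoHausdorff (fun m => (K m : Set (EuclideanSpace ℝ (Fin n)))) D :=
  ⟨fun m _ => ⟨(K m).nonempty, (K m).isCompact⟩, ⟨D.nonempty, D.isCompact⟩,
    tendsto_iff_dist_tendsto_zero.1 h⟩

end UnitCell

section Stationary

open Metric

variable {n : ℕ} {Ω : Type*} [MeasurableSpace Ω] {P : Measure Ω}

/-- A random speed `a` with values in `[α, β]` which is `ℤⁿ`-periodic in space and stationary in
time: running the time for one unit amounts to applying `T : Ω → Ω`. In contrast to `AssumptionA`,
`T` need not be invertible and `a(·, ·, ω)` need only be continuous. -/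
structure IsStationarySpeed (T : Ω → Ω) (a : EuclideanSpace ℝ (Fin n) → ℝ → Ω → ℝ) (α β : ℝ) :
    Prop where
  measurable : Measurable fun p : (EuclideanSpace ℝ (Fin n) × ℝ) × Ω => a p.1.1 p.1.2 p.2
  continuous : ∀ ω, Continuous fun p : EuclideanSpace ℝ (Fin n) × ℝ => a p.1 p.2 ω
  periodic : ∀ l ∈ integerLattice n, ∀ x t ω, a (x + l) t ω = a x t ω
  shift : ∀ x t ω, a x (t + 1) ω = a x t (T ω)
  alpha_pos : 0 < α
  lower : ∀ x t ω, α ≤ a x t ω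
  upper : ∀ x t ω, a x t ω ≤ β

theorem IsErgodicGroup.apply_apply {τ : ℤ → Ω → Ω} (hτ : IsErgodicGroup P τ) (k k' : ℤ) (ω : Ω) :
    τ k (τ k' ω) = τ (k + k') ω := by
  rw [hτ.map_add, Function.comp_apply]

theorem IsErgodicGroup.apply_mem_iff {τ : ℤ → Ω → Ω} (hτ : IsErgodicGroup P τ) {U : Set Ω}
    (hU : τ 1 ⁻¹' U = U) (k : ℤ) (ω : Ω) : τ k ω ∈ U ↔ ω ∈ U := by
  have hone : ∀ ω, τ 1 ω ∈ U ↔ ω ∈ U := Set.ext_iff.1 hU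
  induction k using Int.induction_on with
  | zero => rw [hτ.map_zero, id]
  | succ k ih => rwa [add_comm, ← hτ.apply_apply, hone]
  | pred k ih => rwa [← hone, hτ.apply_apply, add_sub_cancel]

theorem IsErgodicGroup.ergodic_one [IsProbabilityMeasure P] {τ : ℤ → Ω → Ω}
    (hτ : IsErgodicGroup P τ) : Ergodic (τ 1) P where
  toMeasurePreserving := hτ.measurePreserving 1
  aeconst_set U hU hinv := by
    have himage : ∀ k, τ k '' U = U := fun k => by
      refine Set.Subset.antisymm (Set.image_subset_iff.2 fun ω => (hτ.apply_mem_iff hinv k ω).2)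
        fun ω hω => ⟨τ (-k) ω, (hτ.apply_mem_iff hinv (-k) ω).2 hω, ?_⟩
      rw [hτ.apply_apply, add_neg_cancel, hτ.map_zero, id]
    rw [eventuallyConst_set]
    exact (hτ.ergodic U hU himage).imp (mem_ae_iff_prob_eq_one hU).2 measure_eq_zero_iff_ae_notMem.1

theorem AssumptionA.isStationarySpeed {τ : ℤ → Ω → Ω} {a : EuclideanSpace ℝ (Fin n) → ℝ → Ω → ℝ}
    {α β : ℝ} (hA : AssumptionA τ a α β) (hτ : τ 0 = id) : IsStationarySpeed (τ 1) a α β where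
  measurable := hA.measurable
  continuous ω := let ⟨_, hK⟩ := hA.lipschitz ω; hK.continuous
  periodic l hl x t ω := by simpa [hτ] using hA.periodic_stationary x l hl t 0 ω
  shift x t ω := by
    simpa using (hA.periodic_stationary x 0 (fun _ => ⟨0, Int.cast_zero.symm⟩) t 1 ω).symm
  alpha_pos := hA.alpha_pos
  lower := hA.lower
  upper := hA.upper

namespace IsStationarySpeed

variable {T : Ω → Ω} {a : EuclideanSpace ℝ (Fin n) → ℝ → Ω → ℝ} {α β : ℝ}

theorem nonneg (h : IsStationarySpeed T a α β) (x : EuclideanSpace ℝ (Fin n)) (t : ℝ) (ω : Ω) :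
    0 ≤ a x t ω :=
  h.alpha_pos.le.trans (h.lower x t ω)

theorem norm_le (h : IsStationarySpeed T a α β) (x : EuclideanSpace ℝ (Fin n)) (t : ℝ) (ω : Ω) :
    ‖a x t ω‖ ≤ β := by
  rw [Real.norm_of_nonneg (h.nonneg x t ω)]
  exact h.upper x t ω

theorem iterate_shift (h : IsStationarySpeed T a α β) (m : ℕ) (x : EuclideanSpace ℝ (Fin n))
    (t : ℝ) (ω : Ω) : a x (t + m) ω = a x t (T^[m] ω) := by
  induction m generalizing ω with
  | zero => simp
  | succ m ih => rw [Nat.cast_succ, ← add_assoc, h.shift, ih, Function.iterate_succ_apply]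

theorem reachY_eq (h : IsStationarySpeed T a α β) (m : ℕ) (ω : Ω) :
    reachY a m ω = reachSet (a · · ω) 0 m (unitCell n) :=
  reachY_eq_reachSet (h.continuous ω) (h.norm_le · · ω) m.cast_nonneg

theorem reachY_nonempty (h : IsStationarySpeed T a α β) (m : ℕ) (ω : Ω) :
    (reachY a m ω).Nonempty := by
  rw [h.reachY_eq]
  exact ⟨0, subset_reachSet (h.continuous ω) (h.nonneg · · ω) m.cast_nonneg (zero_mem_unitCell n)⟩

theorem isCompact_reachY (h : IsStationarySpeed T a α β) (m : ℕ) (ω : Ω) :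
    IsCompact (reachY a m ω) := by
  rw [h.reachY_eq]
  exact isCompact_reachSet (h.continuous ω) (h.norm_le · · ω) m.cast_nonneg (isCompact_unitCell n)

theorem reachY_subset_closedBall (h : IsStationarySpeed T a α β) (m : ℕ) (ω : Ω) :
    reachY a m ω ⊆ closedBall 0 (√n + β * m) := by
  rw [h.reachY_eq]
  simpa using reachSet_subset_closedBall (h.norm_le · · ω) m.cast_nonneg
    (unitCell_subset_closedBall n)

theorem closedBall_subset_reachY (h : IsStationarySpeed T a α β) (m : ℕ) (ω : Ω) :
    closedBall 0 (α * m) ⊆ reachY a m ω := by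
  rw [h.reachY_eq]
  exact fun y hy => ⟨0, zero_mem_unitCell n, reaches_of_dist_le (h.continuous ω) h.alpha_pos.le
    (h.lower · · ω) m.cast_nonneg (by simpa using hy)⟩

theorem integrable_supportFn_reachY [IsFiniteMeasure P] (h : IsStationarySpeed T a α β) (m : ℕ)
    (u : EuclideanSpace ℝ (Fin n)) : Integrable (fun ω => supportFn (reachY a m ω) u) P := by
  have hmeas : Measurable fun ω => supportFn (reachY a m ω) u := by
    simp only [h.reachY_eq]
    exact measurable_supportFn_reachSet h.measurable h.continuous h.nonneg h.norm_le m.cast_nonneg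
      (isCompact_unitCell n) ⟨0, zero_mem_unitCell n⟩ u
  exact .of_bound hmeas.aestronglyMeasurable ((√n + β * m) * ‖u‖) (ae_of_all _ fun ω =>
    abs_supportFn_le (h.reachY_nonempty m ω) (h.reachY_subset_closedBall m ω) u)

theorem abs_supportFn_reachY_add_sub_sub_le (h : IsStationarySpeed T a α β) (m k : ℕ) (ω : Ω)
    (u : EuclideanSpace ℝ (Fin n)) :
    |supportFn (reachY a (m + k : ℕ) ω) u - supportFn (reachY a m ω) u -
      supportFn (reachY a k (T^[m] ω)) u| ≤ (2 * √n + β * (√n / α)) * ‖u‖ := by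
  simp only [h.reachY_eq]
  rw [Nat.cast_add]
  exact abs_supportFn_reachSet_add_sub_sub_le (h.continuous _) (h.continuous _) h.alpha_pos
    (h.lower · · _) (h.lower · · _) (h.norm_le · · _) (h.norm_le · · _)
    (unitCell_subset_closedBall n) exists_integerLattice_sub_mem_unitCell
    (fun l hl x r => by rw [h.periodic l hl, h.iterate_shift]) m.cast_nonneg k.cast_nonneg u

theorem exists_ae_tendsto_supportFn_reachY [IsProbabilityMeasure P] (hT : Ergodic T P)
    (h : IsStationarySpeed T a α β) (u : EuclideanSpace ℝ (Fin n)) :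
    ∃ c, ∀ᵐ ω ∂P, Tendsto (fun m : ℕ => supportFn (reachY a m ω) u / m) atTop (𝓝 c) :=
  exists_ae_tendsto_div_of_almost_additive hT (h.integrable_supportFn_reachY · u)
    (h.abs_supportFn_reachY_add_sub_sub_le · · · u)

/-- The convex body `co ℛ_m(Y)(ω)`. -/
def reachBody (h : IsStationarySpeed T a α β) (m : ℕ) (ω : Ω) :
    ConvexBody (EuclideanSpace ℝ (Fin n)) :=
  ⟨convexHull ℝ (reachY a m ω), convex_convexHull ℝ _,
    isCompact_convexHull (h.isCompact_reachY m ω), (h.reachY_nonempty m ω).convexHull⟩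

theorem coe_inv_smul_reachBody (h : IsStationarySpeed T a α β) (m : ℕ) (ω : Ω) :
    (((m : ℝ)⁻¹ • h.reachBody m ω : ConvexBody (EuclideanSpace ℝ (Fin n))) :
      Set (EuclideanSpace ℝ (Fin n))) = (m : ℝ)⁻¹ • convexHull ℝ (reachY a m ω) :=
  rfl

theorem supportFn_inv_smul_reachBody (h : IsStationarySpeed T a α β) (m : ℕ) (ω : Ω)
    (u : EuclideanSpace ℝ (Fin n)) :
    supportFn ((m : ℝ)⁻¹ • h.reachBody m ω : ConvexBody (EuclideanSpace ℝ (Fin n))) u =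
      supportFn (reachY a m ω) u / m := by
  rw [coe_inv_smul_reachBody, supportFn_smul (by positivity), supportFn_convexHull
    (h.isCompact_reachY m ω).isBounded (h.reachY_nonempty m ω), div_eq_inv_mul]

theorem inv_smul_reachBody_subset_closedBall (h : IsStationarySpeed T a α β) (m : ℕ) (ω : Ω) :
    (((m : ℝ)⁻¹ • h.reachBody m ω : ConvexBody (EuclideanSpace ℝ (Fin n))) :
      Set (EuclideanSpace ℝ (Fin n))) ⊆ closedBall 0 ((m : ℝ)⁻¹ * √n + β) := by
  rw [coe_inv_smul_reachBody]
  rintro _ ⟨y, hy, rfl⟩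
  have hβ : 0 ≤ β := (norm_nonneg _).trans (h.norm_le 0 0 ω)
  have hy' : ‖y‖ ≤ √n + β * m := mem_closedBall_zero_iff.1
    (convexHull_min (h.reachY_subset_closedBall m ω) (convex_closedBall 0 _) hy)
  rw [mem_closedBall_zero_iff]
  calc ‖(m : ℝ)⁻¹ • y‖ = (m : ℝ)⁻¹ * ‖y‖ := by rw [norm_smul, norm_inv, RCLike.norm_natCast]
    _ ≤ (m : ℝ)⁻¹ * (√n + β * m) := by gcongr
    _ = (m : ℝ)⁻¹ * √n + β * ((m : ℝ)⁻¹ * m) := by ring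
    _ ≤ (m : ℝ)⁻¹ * √n + β := by
      gcongr
      exact mul_le_of_le_one_right hβ inv_mul_le_one

theorem closedBall_subset_inv_smul_reachBody (h : IsStationarySpeed T a α β) {m : ℕ} (hm : m ≠ 0)
    (ω : Ω) : closedBall 0 α ⊆
      (((m : ℝ)⁻¹ • h.reachBody m ω : ConvexBody (EuclideanSpace ℝ (Fin n))) :
        Set (EuclideanSpace ℝ (Fin n))) := by
  intro y hy
  rw [coe_inv_smul_reachBody, Set.mem_inv_smul_set_iff₀ (Nat.cast_ne_zero.2 hm)]
  refine subset_convexHull ℝ _ (h.closedBall_subset_reachY m ω ?_)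
  rw [mem_closedBall_zero_iff] at hy ⊢
  rw [norm_smul, RCLike.norm_natCast, mul_comm]
  gcongr

theorem exists_ae_tendsto_inv_smul_reachBody [IsProbabilityMeasure P] (hT : Ergodic T P)
    (h : IsStationarySpeed T a α β) :
    ∃ D, ∀ᵐ ω ∂P, Tendsto (fun m : ℕ => (m : ℝ)⁻¹ • h.reachBody m ω) atTop (𝓝 D) := by
  refine exists_ae_tendsto_of_tendsto_supportFn (M := √n + β)
    (fun m ω => (h.inv_smul_reachBody_subset_closedBall m ω).trans
      (closedBall_subset_closedBall ?_)) fun u => ?_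
  · gcongr
    exact mul_le_of_le_one_left (Real.sqrt_nonneg _) (Nat.cast_inv_le_one m)
  · simpa only [h.supportFn_inv_smul_reachBody] using h.exists_ae_tendsto_supportFn_reachY hT u

end IsStationarySpeed

end Stationary

end ReachableSets

theorem mainTheorem4_general {n : ℕ} {Ω : Type*} [MeasurableSpace Ω] {P : Measure Ω}
    [IsProbabilityMeasure P] {T : Ω → Ω} (hT : Ergodic T P)
    {a : EuclideanSpace ℝ (Fin n) → ℝ → Ω → ℝ} {α β : ℝ}
    (ha : ReachableSets.IsStationarySpeed T a α β) :
    ∃ D : Set (EuclideanSpace ℝ (Fin n)),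
      IsCompact D ∧ Convex ℝ D ∧
      Metric.closedBall 0 α ⊆ D ∧ D ⊆ Metric.closedBall 0 β ∧
      ∃ Ω₀ : Set Ω, MeasurableSet Ω₀ ∧ P Ω₀ = 1 ∧
        ∀ ω ∈ Ω₀,
          ReachableSets.TendstoHausdorff (fun m : ℕ => (m : ℝ)⁻¹ •
            (convexHull ℝ (ReachableSets.reachY a m ω) + -ReachableSets.unitCell n)) D ∧
          ReachableSets.TendstoHausdorff
            (fun m : ℕ => (m : ℝ)⁻¹ • convexHull ℝ (ReachableSets.reachY a m ω)) D := by
  open ReachableSets in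
  obtain ⟨D, hD⟩ := ha.exists_ae_tendsto_inv_smul_reachBody hT
  obtain ⟨Ω₀, hΩ₀_ae, hΩ₀, hlim⟩ := hD.exists_measurable_mem
  obtain ⟨ω₀, hω₀⟩ := Filter.nonempty_of_mem hΩ₀_ae
  have hradius : Tendsto (fun m : ℕ => (m : ℝ)⁻¹ * √n + β) atTop (𝓝 β) := by
    simpa using ((tendsto_inv_atTop_nhds_zero_nat (𝕜 := ℝ)).mul_const √(n : ℝ)).add_const β
  refine ⟨D, D.isCompact, D.convex, subset_of_tendsto ?_ (hlim ω₀ hω₀),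
    subset_closedBall_of_tendsto (ha.inv_smul_reachBody_subset_closedBall · ω₀) (hlim ω₀ hω₀)
      hradius, Ω₀, hΩ₀, (mem_ae_iff_prob_eq_one hΩ₀).1 hΩ₀_ae, fun ω hω => ⟨?_, ?_⟩⟩
  · filter_upwards [eventually_ne_atTop 0] with m hm
      using ha.closedBall_subset_inv_smul_reachBody hm ω₀
  · exact tendstoHausdorff_coe ((tendsto_inv_smul_add_iff (negUnitCell n)).2 (hlim ω hω))
  · exact tendstoHausdorff_coe (hlim ω hω)

theorem mainTheorem4 {n : ℕ} {Ω : Type*} [MeasurableSpace Ω] (P : Measure Ω)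
    [IsProbabilityMeasure P] (τ : ℤ → Ω → Ω) (hτ : ReachableSets.IsErgodicGroup P τ)
    (a : EuclideanSpace ℝ (Fin n) → ℝ → Ω → ℝ) (α β : ℝ)
    (hA : ReachableSets.AssumptionA τ a α β) :
    ∃ D : Set (EuclideanSpace ℝ (Fin n)),
      IsCompact D ∧ Convex ℝ D ∧
      Metric.closedBall 0 α ⊆ D ∧ D ⊆ Metric.closedBall 0 β ∧
      ∃ Ω₀ : Set Ω, MeasurableSet Ω₀ ∧ P Ω₀ = 1 ∧
        ∀ ω ∈ Ω₀,
          ReachableSets.TendstoHausdorff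
            (fun m : ℕ => (m : ℝ)⁻¹ • ReachableSets.X τ a 0 m ω) D ∧
          ReachableSets.TendstoHausdorff
            (fun m : ℕ => (m : ℝ)⁻¹ • convexHull ℝ (ReachableSets.reachY a (m : ℝ) ω)) D := by
  simpa [ReachableSets.X, hτ.map_zero] using
    mainTheorem4_general hτ.ergodic_one (hA.isStationarySpeed hτ.map_zero)
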